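/- **Setting.** Let $N,K\in\mathbb{N}$, let $b\in\mathbb{R}^N$ have strictly positive entries with $\sum_i b_i=1$, let $x_1,\dots,x_N\in\mathbb{R}^K$, and let $t$ lie in the relative interior of $\mathrm{conv}\{x_1,\dots,x_N\}$. For $\theta\in\mathbb{R}^K$ put $$L(\theta)=\theta^\top t-\log\sum_i b_i e^{\theta^\top x_i},\qquad w_i(\theta)=\frac{b_i e^{\theta^\top x_i}}{\sum_j b_j e^{\theta^\top x_j}},$$ $$\mu(\theta)=\sum_i w_i(\theta)x_i,\qquad g(\theta)=t-\mu(\theta),\qquad \Sigma(\theta)=\mathrm{Cov}_{w(\theta)}(x)=\sum_i w_i(\theta)(x_i-\mu(\theta))(x_i-\mu(\theta))^\top .$$ Fix $0<c<\tfrac12$ and $0<\beta<1$. A *damped Newton run* with ridge parameters $\delta_k\ge 0$ is a sequence $(\theta_k)_{k\ge0}$ with arbitrary starting point $\theta_0\in\mathbb{R}^K$ and $\theta_{k+1}=\theta_k+\alpha_k\Delta_k$, where $\Delta_k$ is a solution of $$(\Sigma(\theta_k)+\delta_k I)\,\Delta_k=g(\theta_k)$$ and $\alpha_k$ is the largest element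 of $\{\beta^j: j=0,1,2,\dots\}$ with $L(\theta_k+\alpha_k\Delta_k)\ge L(\theta_k)+c\,\alpha_k\,g(\theta_k)^\top\Delta_k$. **Theorem (Convergence of EGMU-Newton).** 1. *(Well-posedness.)* $L$ attains its maximum on $\mathbb{R}^K$. For every $\theta\in\mathbb{R}^K$ and $\delta\ge0$ the system $(\Sigma(\theta)+\delta I)\Delta=g(\theta)$ has a solution, and for every solution $\Delta$ there is $j\ge 0$ for which $\alpha=\beta^j$ satisfies the Armijo condition $L(\theta+\alpha\Delta)\ge L(\theta)+c\,\alpha\,g(\theta)^\top\Delta$. 2. *(Global convergence.)* For every damped Newton run with bounded ridge parameters $\delta_k\ge0$: $L(\theta_k)$ is nondecreasing, $\nabla L(\theta_k)\to0$, $\mu(\theta_k)\to t$, and for every maximizer $\theta^\star$ of $L$, $L(\theta_k)\to L(\theta^\star)$ and $w(\theta_k)\to w(\theta^\star)$; moreover the distance of $\theta_k$ to the set of maximizers of $L$ tends to $0$. If in addition $\Delta_k\in\mathrm{range}\,\Sigma(\theta_k)$ for every $k$ (which excludes only a freedom that exists when $\delta_k=0$ and $\Sigma(\theta_k)$ is singular),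 then $\theta_k$ converges to a maximizer of $L$. 3. *(Local quadratic convergence.)* Let $\theta^\star$ be a maximizer of $L$, and suppose that there are a neighbourhood $U$ of $\theta^\star$ and constants $m>0$, $M\ge0$ such that $\Sigma(\theta)\succeq mI$ for all $\theta\in U$ and $\nabla^2L$ is $M$-Lipschitz on $U$ (in operator norm). Then: - there is $r>0$ such that every damped Newton run with $\delta_k=0$ for all $k$ and $\|\theta_0-\theta^\star\|_2<r$ converges to $\theta^\star$ and satisfies, for all $k\ge0$, $\alpha_k=1$ and $$\|\theta_{k+1}-\theta^\star\|_2\le\frac{M}{2m}\,\|\theta_k-\theta^\star\|_2^2;$$ - every damped Newton run (with arbitrary $\theta_0$) with bounded $\delta_k\ge0$ and $\delta_k=0$ for all sufficiently large $k$ converges to $\theta^\star$, and $\alpha_k=1$ and the same quadratic estimate hold for all sufficiently large $k$. -/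

import Mathlib

open Set Filter Topology
open scoped NNReal Matrix Gradient

noncomputable section

/-- The partition function `Z(θ) = ∑ᵢ bᵢ exp(θᵀ xᵢ)`. Here `b` is the prior and `x i` is the
`i`-th row of the exposure matrix. -/
def partitionFn {N K : ℕ} (b : Fin N → ℝ) (x : Fin N → EuclideanSpace ℝ (Fin K))
    (θ : EuclideanSpace ℝ (Fin K)) : ℝ :=
  ∑ i, b i * Real.exp (inner ℝ θ (x i))

/-- The exponential tilt `wᵢ(θ) = bᵢ exp(θᵀ xᵢ) / ∑ⱼ bⱼ exp(θᵀ xⱼ)`. -/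
def tilt {N K : ℕ} (b : Fin N → ℝ) (x : Fin N → EuclideanSpace ℝ (Fin K))
    (θ : EuclideanSpace ℝ (Fin K)) : Fin N → ℝ :=
  fun i => b i * Real.exp (inner ℝ θ (x i)) / partitionFn b x θ

/-- The dual objective `L(θ) = θᵀ t - log ∑ᵢ bᵢ exp(θᵀ xᵢ)`. -/
def dualObj {N K : ℕ} (b : Fin N → ℝ) (x : Fin N → EuclideanSpace ℝ (Fin K))
    (t θ : EuclideanSpace ℝ (Fin K)) : ℝ :=
  inner ℝ θ t - Real.log (partitionFn b x θ)

/-- The mean `E_w[x] = ∑ᵢ wᵢ xᵢ`. -/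
def wMean {N K : ℕ} (w : Fin N → ℝ) (x : Fin N → EuclideanSpace ℝ (Fin K)) :
    EuclideanSpace ℝ (Fin K) :=
  ∑ i, w i • x i

/-- The covariance matrix `Cov_w(x) = ∑ᵢ wᵢ (xᵢ - μ)(xᵢ - μ)ᵀ` with `μ = E_w[x]`. -/
def wCov {N K : ℕ} (w : Fin N → ℝ) (x : Fin N → EuclideanSpace ℝ (Fin K)) :
    Matrix (Fin K) (Fin K) ℝ :=
  ∑ i, w i • Matrix.vecMulVec (fun j => (x i - wMean w x) j) (fun j => (x i - wMean w x) j)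

/-- The residual `g(θ) = t - E_{w(θ)}[x]` used by the algorithm. -/
def dualResidual {N K : ℕ} (b : Fin N → ℝ) (x : Fin N → EuclideanSpace ℝ (Fin K))
    (t θ : EuclideanSpace ℝ (Fin K)) : EuclideanSpace ℝ (Fin K) :=
  t - wMean (tilt b x θ) x

/-- `Δ` is a (ridge-regularized) Newton direction at `θ`: `(Cov_{w(θ)}(x) + δ I) Δ = g(θ)`. -/
def IsNewtonDir {N K : ℕ} (b : Fin N → ℝ) (x : Fin N → EuclideanSpace ℝ (Fin K))
    (t : EuclideanSpace ℝ (Fin K)) (δ : ℝ) (θ Δ : EuclideanSpace ℝ (Fin K)) : Prop :=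
  Matrix.toEuclideanLin (wCov (tilt b x θ) x + δ • (1 : Matrix (Fin K) (Fin K) ℝ)) Δ =
    dualResidual b x t θ

/-- The Armijo condition `L(θ + α Δ) ≥ L(θ) + c α gᵀΔ`. -/
def Armijo {N K : ℕ} (b : Fin N → ℝ) (x : Fin N → EuclideanSpace ℝ (Fin K))
    (t : EuclideanSpace ℝ (Fin K)) (c : ℝ) (θ Δ : EuclideanSpace ℝ (Fin K)) (α : ℝ) : Prop :=
  dualObj b x t θ + c * α * inner ℝ (dualResidual b x t θ) Δ ≤ dualObj b x t (θ + α • Δ)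

/-- A run of damped Newton ascent with Armijo backtracking: `θ k` are the iterates, `δ k` the
ridge parameters, `Δ k` the search directions, and `β ^ n k` the step lengths, where `n k` is
the number of backtracking steps, so that `β ^ n k` is the largest power of `β` that satisfies
the Armijo condition. -/
structure IsNewtonRun {N K : ℕ} (b : Fin N → ℝ) (x : Fin N → EuclideanSpace ℝ (Fin K))
    (t : EuclideanSpace ℝ (Fin K)) (c β : ℝ) (δ : ℕ → ℝ)
    (θ Δ : ℕ → EuclideanSpace ℝ (Fin K)) (n : ℕ → ℕ) : Prop where
  dir : ∀ k, IsNewtonDir b x t (δ k) (θ k) (Δ k)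
  search : ∀ k, IsLeast {j : ℕ | Armijo b x t c (θ k) (Δ k) (β ^ j)} (n k)
  step : ∀ k, θ (k + 1) = θ k + β ^ n k • Δ k

end

section Newton

variable {N K : ℕ} {b : Fin N → ℝ} {x : Fin N → EuclideanSpace ℝ (Fin K)}
  {t θ θ' θs : EuclideanSpace ℝ (Fin K)}

/-! `L` is concave with gradient `g` and Hessian `-Σ`. Both `L` and the tilt are constant along
directions orthogonal to all `x i - t`. These are also the only directions in which `Σ` degenerates:
if `vᵀΣv = 0`, then `v` is constant on the points, and since `t` is a relative interior point, `v`
annihilates every `x i - t`. Hence projecting a run onto `V = centredSpan x t` gives a run with the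
same step lengths (`IsNewtonRun.starProjection`), and the analysis takes place in `V`.

In `V` superlevel sets are compact (`isCompact_superlevel`), so a maximizer exists, and it is unique
in `V`. On such a set `Σ ≥ m` on `V` (`exists_wCov_coercive`), while `Σ ≤ Λ` everywhere.
Backtracking therefore keeps the steps bounded below (`min_le_pow_of_isLeast_armijo`), and each
iteration gains at least a fixed multiple of `‖Δ‖²`. Since `L` is bounded above, `Δ → 0`; bounded
ridges then give `g → 0`, and every cluster point is the maximizer. The component of the iterates
off `V` does not affect `L`, and it never moves when `Δ` lies in the range of `Σ`.

Locally, Taylor expansion of `g` gives the quadratic estimate for a full step. The full step passes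
Armijo near the maximizer because its gain is `gᵀΔ / 2` up to a cubic error, and `c < 1/2` leaves a
quadratic margin. -/

lemma nonempty_of_sum_eq_one (hb1 : ∑ i, b i = 1) : Nonempty (Fin N) := by
  by_contra h
  rw [not_nonempty_iff] at h
  simp at hb1

/-! ### Identities for the partition function, the tilt and the covariance operator -/

lemma partitionFn_pos [Nonempty (Fin N)] (hb : ∀ i, 0 < b i) (θ : EuclideanSpace ℝ (Fin K)) :
    0 < partitionFn b x θ :=
  Finset.sum_pos (fun i _ => mul_pos (hb i) (Real.exp_pos _)) Finset.univ_nonempty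

lemma tilt_pos [Nonempty (Fin N)] (hb : ∀ i, 0 < b i) (θ : EuclideanSpace ℝ (Fin K)) (i : Fin N) :
    0 < tilt b x θ i :=
  div_pos (mul_pos (hb i) (Real.exp_pos _)) (partitionFn_pos hb θ)

lemma sum_tilt [Nonempty (Fin N)] (hb : ∀ i, 0 < b i) (θ : EuclideanSpace ℝ (Fin K)) :
    ∑ i, tilt b x θ i = 1 := by
  simp only [tilt, ← Finset.sum_div]
  exact div_self (partitionFn_pos hb θ).ne'

lemma sum_smul_sub_wMean {w : Fin N → ℝ} (hw : ∑ i, w i = 1) :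
    ∑ i, w i • (x i - wMean w x) = 0 := by
  simp only [smul_sub, Finset.sum_sub_distrib, ← Finset.sum_smul, hw, one_smul]
  exact sub_self _

lemma sum_smul_sub {w : Fin N → ℝ} (hw : ∑ i, w i = 1) (t : EuclideanSpace ℝ (Fin K)) :
    ∑ i, w i • (x i - t) = wMean w x - t := by
  simp only [smul_sub, Finset.sum_sub_distrib, ← Finset.sum_smul, hw, one_smul]
  rfl

lemma toEuclideanLin_wCov_apply (w : Fin N → ℝ) (v : EuclideanSpace ℝ (Fin K)) :
    Matrix.toEuclideanLin (wCov w x) v =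
      ∑ i, (w i * inner ℝ (x i - wMean w x) v) • (x i - wMean w x) := by
  simp only [wCov, map_sum, map_smul, LinearMap.sum_apply, LinearMap.smul_apply, mul_smul]
  refine Finset.sum_congr rfl fun i _ => ?_
  congr 1
  ext j
  simp only [Matrix.toLpLin_apply, Matrix.mulVec, Matrix.vecMulVec, dotProduct, Matrix.of_apply,
    PiLp.smul_apply, smul_eq_mul, PiLp.inner_apply, RCLike.inner_apply, conj_trivial,
    Finset.sum_mul]
  exact Finset.sum_congr rfl fun k _ => by ring

lemma inner_toEuclideanLin_wCov (w : Fin N → ℝ) (v u : EuclideanSpace ℝ (Fin K)) :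
    inner ℝ (Matrix.toEuclideanLin (wCov w x) v) u =
      ∑ i, w i * inner ℝ (x i - wMean w x) v * inner ℝ (x i - wMean w x) u := by
  simp [toEuclideanLin_wCov_apply, sum_inner, inner_smul_left]

lemma toEuclideanLin_add_smul_one (A : Matrix (Fin K) (Fin K) ℝ) (δ : ℝ)
    (v : EuclideanSpace ℝ (Fin K)) :
    Matrix.toEuclideanLin (A + δ • (1 : Matrix (Fin K) (Fin K) ℝ)) v =
      Matrix.toEuclideanLin A v + δ • v := by
  rw [map_add, map_smul, Matrix.toLpLin_one]
  rfl

/-- The partition function at `θ + d` in terms of the tilt at `θ`. -/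
lemma partitionFn_add [Nonempty (Fin N)] (hb : ∀ i, 0 < b i) (θ d : EuclideanSpace ℝ (Fin K)) :
    partitionFn b x (θ + d) =
      partitionFn b x θ * Real.exp (inner ℝ d t) *
        ∑ i, tilt b x θ i * Real.exp (inner ℝ d (x i - t)) := by
  rw [Finset.mul_sum]
  unfold tilt
  conv_lhs => unfold partitionFn
  refine Finset.sum_congr rfl fun i _ => ?_
  have := (partitionFn_pos (x := x) hb θ).ne'
  rw [inner_add_left, Real.exp_add, inner_sub_right, Real.exp_sub]
  field_simp

lemma sum_tilt_mul_exp_pos [Nonempty (Fin N)] (hb : ∀ i, 0 < b i)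
    (θ : EuclideanSpace ℝ (Fin K)) (u : Fin N → ℝ) :
    0 < ∑ i, tilt b x θ i * Real.exp (u i) :=
  Finset.sum_pos (fun i _ => mul_pos (tilt_pos hb θ i) (Real.exp_pos _)) Finset.univ_nonempty

/-- An exact increment formula: the change of `L` is minus a log moment generating function under
the current tilt. Invariance, concavity and uniqueness are all read off from it, without second
derivatives. -/
lemma dualObj_add [Nonempty (Fin N)] (hb : ∀ i, 0 < b i) (θ d : EuclideanSpace ℝ (Fin K)) :
    dualObj b x t (θ + d) =
      dualObj b x t θ - Real.log (∑ i, tilt b x θ i * Real.exp (inner ℝ d (x i - t))) := by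
  unfold dualObj
  rw [partitionFn_add (t := t) hb, Real.log_mul, Real.log_mul, Real.log_exp, inner_add_left]
  · ring
  · exact (partitionFn_pos hb θ).ne'
  · exact (Real.exp_pos _).ne'
  · exact (mul_pos (partitionFn_pos hb θ) (Real.exp_pos _)).ne'
  · exact (sum_tilt_mul_exp_pos hb θ _).ne'

lemma dualObj_add_of_inner_eq_zero [Nonempty (Fin N)] (hb : ∀ i, 0 < b i)
    (θ : EuclideanSpace ℝ (Fin K)) {d : EuclideanSpace ℝ (Fin K)}
    (hd : ∀ i, inner ℝ d (x i - t) = 0) : dualObj b x t (θ + d) = dualObj b x t θ := by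
  simp [dualObj_add hb, hd, sum_tilt hb]

lemma tilt_add_of_inner_eq_zero [Nonempty (Fin N)] (hb : ∀ i, 0 < b i)
    (θ : EuclideanSpace ℝ (Fin K)) {d : EuclideanSpace ℝ (Fin K)}
    (hd : ∀ i, inner ℝ d (x i - t) = 0) : tilt b x (θ + d) = tilt b x θ := by
  ext i
  have h := hd i
  rw [inner_sub_right, sub_eq_zero] at h
  have := (partitionFn_pos (x := x) hb θ).ne'
  have := (Real.exp_pos (inner ℝ d t)).ne'
  rw [tilt, partitionFn_add (t := t) hb]
  simp only [hd, Real.exp_zero, mul_one, sum_tilt hb, inner_add_left, Real.exp_add, h]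
  rw [tilt]
  field_simp

lemma dualObj_eq_neg_log [Nonempty (Fin N)] (hb : ∀ i, 0 < b i) (hb1 : ∑ i, b i = 1)
    (θ : EuclideanSpace ℝ (Fin K)) :
    dualObj b x t θ = -Real.log (∑ i, b i * Real.exp (inner ℝ θ (x i - t))) := by
  have h := dualObj_add (x := x) (t := t) hb 0 θ
  have h0 : tilt b x 0 = b := by ext i; simp [tilt, partitionFn, hb1]
  have h1 : dualObj b x t 0 = 0 := by simp [dualObj, partitionFn, hb1]
  simpa [h0, h1] using h

lemma inner_dualResidual [Nonempty (Fin N)] (hb : ∀ i, 0 < b i)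
    (θ v : EuclideanSpace ℝ (Fin K)) :
    inner ℝ (dualResidual b x t θ) v = -∑ i, tilt b x θ i * inner ℝ v (x i - t) := by
  rw [dualResidual, ← neg_sub, ← sum_smul_sub (sum_tilt hb θ), inner_neg_left, sum_inner]
  simp [inner_smul_left, real_inner_comm]

/-! ### Derivatives -/

lemma hasFDerivAt_partitionFn (θ : EuclideanSpace ℝ (Fin K)) :
    HasFDerivAt (partitionFn b x)
      (∑ i, (b i * Real.exp (inner ℝ θ (x i))) • innerSL ℝ (x i)) θ := by
  unfold partitionFn
  refine HasFDerivAt.fun_sum fun i _ => ?_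
  have h : HasFDerivAt (fun θ : EuclideanSpace ℝ (Fin K) => inner ℝ θ (x i))
      (innerSL ℝ (x i)) θ := by
    simp_rw [real_inner_comm (x i)]
    exact (innerSL ℝ (x i)).hasFDerivAt
  rw [mul_smul]
  exact h.exp.const_mul (b i)

lemma sum_smul_innerSL_eq [Nonempty (Fin N)] (hb : ∀ i, 0 < b i) (θ : EuclideanSpace ℝ (Fin K)) :
    ∑ i, (b i * Real.exp (inner ℝ θ (x i))) • innerSL ℝ (x i) =
      partitionFn b x θ • innerSL ℝ (wMean (tilt b x θ) x) := by
  have := (partitionFn_pos (x := x) hb θ).ne'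
  ext v
  simp only [wMean, tilt, _root_.sum_apply, _root_.smul_apply,
    innerSL_apply_apply, smul_eq_mul, sum_inner, inner_smul_left, Finset.mul_sum, conj_trivial]
  refine Finset.sum_congr rfl fun i _ => ?_
  field_simp

lemma hasGradientAt_dualObj [Nonempty (Fin N)] (hb : ∀ i, 0 < b i)
    (θ : EuclideanSpace ℝ (Fin K)) :
    HasGradientAt (dualObj b x t) (dualResidual b x t θ) θ := by
  rw [hasGradientAt_iff_hasFDerivAt]
  have hZ := (partitionFn_pos (x := x) hb θ).ne'
  have h := hasFDerivAt_partitionFn (b := b) (x := x) θ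
  rw [sum_smul_innerSL_eq hb] at h
  have ht : HasFDerivAt (fun θ : EuclideanSpace ℝ (Fin K) => inner ℝ θ t) (innerSL ℝ t) θ := by
    simp_rw [real_inner_comm t]
    exact (innerSL ℝ t).hasFDerivAt
  refine (ht.sub (h.log hZ)).congr_fderiv ?_
  ext v
  simp [dualResidual, hZ]

lemma gradient_dualObj [Nonempty (Fin N)] (hb : ∀ i, 0 < b i) :
    ∇ (dualObj b x t) = dualResidual b x t :=
  funext fun θ => (hasGradientAt_dualObj hb θ).gradient

lemma hasFDerivAt_tilt [Nonempty (Fin N)] (hb : ∀ i, 0 < b i) (θ : EuclideanSpace ℝ (Fin K))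
    (i : Fin N) :
    HasFDerivAt (fun θ => tilt b x θ i)
      (tilt b x θ i • innerSL ℝ (x i - wMean (tilt b x θ) x)) θ := by
  have hZ := (partitionFn_pos (x := x) hb θ).ne'
  have h := hasFDerivAt_partitionFn (b := b) (x := x) θ
  rw [sum_smul_innerSL_eq hb] at h
  have hi : HasFDerivAt (fun θ : EuclideanSpace ℝ (Fin K) => inner ℝ θ (x i))
      (innerSL ℝ (x i)) θ := by
    simp_rw [real_inner_comm (x i)]
    exact (innerSL ℝ (x i)).hasFDerivAt
  refine ((hi.exp.const_mul (b i)).mul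
    ((hasDerivAt_inv hZ).comp_hasFDerivAt θ h)).congr_fderiv ?_
  ext v
  simp only [tilt, map_sub, _root_.add_apply, _root_.smul_apply, innerSL_apply_apply, smul_eq_mul,
    _root_.sub_apply, Function.comp_apply]
  field_simp
  ring

/-- Differentiating the weights produces only one factor centred at the mean. Centring the other
costs nothing, since the weighted deviations sum to zero. -/
lemma hasFDerivAt_dualResidual [Nonempty (Fin N)] (hb : ∀ i, 0 < b i)
    (θ : EuclideanSpace ℝ (Fin K)) :
    HasFDerivAt (dualResidual b x t)
      (-(Matrix.toEuclideanLin (wCov (tilt b x θ) x)).toContinuousLinearMap) θ := by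
  have h : HasFDerivAt (fun θ => ∑ i, tilt b x θ i • x i)
      (∑ i, (tilt b x θ i • innerSL ℝ (x i - wMean (tilt b x θ) x)).smulRight (x i)) θ :=
    HasFDerivAt.fun_sum fun i _ => (hasFDerivAt_tilt hb θ i).smul_const (x i)
  refine (h.const_sub t).congr_fderiv ?_
  ext1 v
  have h0 : ∑ i, (tilt b x θ i * inner ℝ (x i - wMean (tilt b x θ) x) v) = 0 := by
    have := congrArg (fun y => inner ℝ y v) (sum_smul_sub_wMean (x := x) (sum_tilt (x := x) hb θ))
    simpa [sum_inner, inner_smul_left] using this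
  simp only [_root_.neg_apply, LinearMap.coe_toContinuousLinearMap',
    toEuclideanLin_wCov_apply, smul_sub, Finset.sum_sub_distrib, ← Finset.sum_smul, h0, zero_smul,
    sub_zero]
  simp only [inner_sub_left, _root_.sum_apply, ContinuousLinearMap.smulRight_apply,
    _root_.smul_apply, innerSL_apply_apply, smul_eq_mul, map_sub, _root_.sub_apply]

lemma fderiv_gradient_dualObj [Nonempty (Fin N)] (hb : ∀ i, 0 < b i)
    (θ v : EuclideanSpace ℝ (Fin K)) :
    fderiv ℝ (∇ (dualObj b x t)) θ v = -Matrix.toEuclideanLin (wCov (tilt b x θ) x) v := by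
  rw [gradient_dualObj hb, (hasFDerivAt_dualResidual hb θ).fderiv]
  rfl

lemma continuous_dualResidual [Nonempty (Fin N)] (hb : ∀ i, 0 < b i) :
    Continuous (dualResidual b x t) :=
  continuous_iff_continuousAt.2 fun θ => (hasFDerivAt_dualResidual hb θ).continuousAt

lemma continuous_tilt [Nonempty (Fin N)] (hb : ∀ i, 0 < b i) : Continuous (tilt b x) :=
  continuous_pi fun i => continuous_iff_continuousAt.2 fun θ =>
    (hasFDerivAt_tilt hb θ i).continuousAt

lemma continuous_dualObj [Nonempty (Fin N)] (hb : ∀ i, 0 < b i) : Continuous (dualObj b x t) :=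
  continuous_iff_continuousAt.2 fun θ => (hasGradientAt_dualObj hb θ).continuousAt

lemma hasDerivAt_dualObj_line [Nonempty (Fin N)] (hb : ∀ i, 0 < b i)
    (θ d : EuclideanSpace ℝ (Fin K)) (s : ℝ) :
    HasDerivAt (fun s : ℝ => dualObj b x t (θ + s • d))
      (inner ℝ (dualResidual b x t (θ + s • d)) d) s := by
  have h1 : HasDerivAt (fun s : ℝ => θ + s • d) d s := by
    simpa using ((hasDerivAt_id s).smul_const d).const_add θ
  have h2 := (hasGradientAt_dualObj (x := x) (t := t) hb (θ + s • d)).hasFDerivAt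
  have h3 := h2.comp_hasDerivAt s h1
  rwa [InnerProductSpace.toDual_apply_apply] at h3

/-- Subtracting the primitive `p s - q s² / 2` leaves a monotone function. This serves both the
global quadratic lower bound and the sharper local one. -/
lemma add_sub_half_le_of_deriv_ge {φ φ' : ℝ → ℝ} (hφ : ∀ s, HasDerivAt φ (φ' s) s) {p q : ℝ}
    (h : ∀ s ∈ Ioo (0 : ℝ) 1, p - q * s ≤ φ' s) : φ 0 + p - q / 2 ≤ φ 1 := by
  have hd : ∀ s, HasDerivAt (fun s => φ s - (p * s - q * s ^ 2 / 2)) (φ' s - (p - q * s)) s := by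
    intro s
    refine (hφ s).sub ?_
    have h1 : HasDerivAt (fun s : ℝ => p * s) p s := by
      simpa using (hasDerivAt_id s).const_mul p
    have h2 : HasDerivAt (fun s : ℝ => q * s ^ 2 / 2) (q * s) s := by
      refine (((hasDerivAt_pow 2 s).const_mul q).div_const 2).congr_deriv ?_
      norm_num
      ring
    exact h1.sub h2
  have hm : MonotoneOn (fun s => φ s - (p * s - q * s ^ 2 / 2)) (Icc 0 1) := by
    refine monotoneOn_of_deriv_nonneg (convex_Icc 0 1)
      (fun s _ => (hd s).continuousAt.continuousWithinAt)
      (fun s _ => (hd s).differentiableAt.differentiableWithinAt) fun s hs => ?_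
    rw [interior_Icc] at hs
    rw [(hd s).deriv]
    linarith [h s hs]
  have := hm (left_mem_Icc.2 zero_le_one) (right_mem_Icc.2 zero_le_one) zero_le_one
  simp only at this
  linarith

/-! ### The relative interior condition -/

/-- A linear functional that is maximal over the points at a relative interior point of their
convex hull is constant on the points. -/
lemma inner_eq_zero_of_mem_intrinsicInterior
    (ht : t ∈ intrinsicInterior ℝ (convexHull ℝ (range x))) (v : EuclideanSpace ℝ (Fin K))
    (hv : ∀ i, inner ℝ v (x i - t) ≤ 0) (i : Fin N) : inner ℝ v (x i - t) = 0 := by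
  obtain ⟨y, hy, rfl⟩ := mem_intrinsicInterior.1 ht
  refine le_antisymm (hv i) ?_
  have hxi : x i ∈ affineSpan ℝ (convexHull ℝ (range x)) :=
    subset_affineSpan ℝ _ (subset_convexHull ℝ _ (mem_range_self i))
  -- The line through `t` and `x i`, inside the affine span. For small negative `s` it passes `t` on
  -- the side away from `x i` and still lies in the hull, so `v` cannot decrease from `t` to `x i`.
  let f : ℝ → affineSpan ℝ (convexHull ℝ (range x)) := fun s =>
    ⟨AffineMap.lineMap (y : EuclideanSpace ℝ (Fin K)) (x i) s,
      AffineMap.lineMap_mem s y.2 hxi⟩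
  have hf : Continuous f := AffineMap.lineMap_continuous.subtype_mk _
  have hf0 : f 0 = y := Subtype.ext (AffineMap.lineMap_apply_zero _ _)
  have hev : ∀ᶠ s in 𝓝 (0 : ℝ), f s ∈ interior ((↑) ⁻¹' convexHull ℝ (range x) :
      Set (affineSpan ℝ (convexHull ℝ (range x)))) :=
    hf.continuousAt.eventually_mem (by rw [hf0]; exact isOpen_interior.mem_nhds hy)
  obtain ⟨s, hs, hs0⟩ := ((hev.filter_mono nhdsWithin_le_nhds).and
    (self_mem_nhdsWithin : Iio (0 : ℝ) ∈ 𝓝[<] 0)).exists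
  have hmem : AffineMap.lineMap (y : EuclideanSpace ℝ (Fin K)) (x i) s ∈ convexHull ℝ (range x) :=
    have := interior_subset (s := ((↑) ⁻¹' convexHull ℝ (range x) :
      Set (affineSpan ℝ (convexHull ℝ (range x))))) hs
    this
  have hconv : Convex ℝ {z : EuclideanSpace ℝ (Fin K) | inner ℝ v z ≤ inner ℝ v y} :=
    convex_halfSpace_le (innerₛₗ ℝ v).isLinear _
  have hsub : convexHull ℝ (range x) ⊆
      {z | inner ℝ v z ≤ inner ℝ v (y : EuclideanSpace ℝ (Fin K))} := by
    refine convexHull_min ?_ hconv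
    rintro _ ⟨j, rfl⟩
    have := hv j
    rw [inner_sub_right] at this
    exact sub_nonpos.1 this
  have h : inner ℝ v _ ≤ inner ℝ v (y : EuclideanSpace ℝ (Fin K)) := hsub hmem
  simp only [AffineMap.lineMap_apply, vsub_eq_sub, vadd_eq_add, inner_add_right,
    inner_smul_right] at h
  have hs0' : s < 0 := hs0
  nlinarith

/-! ### The covariance operator -/

lemma inner_sub_wMean {w : Fin N → ℝ} (hw : ∑ i, w i = 1) {v : EuclideanSpace ℝ (Fin K)}
    (hv : ∀ i, inner ℝ v (x i - t) = 0) (i : Fin N) : inner ℝ (x i - wMean w x) v = 0 := by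
  have h : x i - wMean w x = (x i - t) - ∑ j, w j • (x j - t) := by
    rw [sum_smul_sub hw]; abel
  rw [real_inner_comm, h, inner_sub_right, inner_sum]
  simp [inner_smul_right, hv]

lemma wCov_apply_eq_zero {w : Fin N → ℝ} (hw : ∑ i, w i = 1) {v : EuclideanSpace ℝ (Fin K)}
    (hv : ∀ i, inner ℝ v (x i - t) = 0) : Matrix.toEuclideanLin (wCov w x) v = 0 := by
  simp [toEuclideanLin_wCov_apply, inner_sub_wMean hw hv]

lemma wCov_inner_self_nonneg {w : Fin N → ℝ} (hw : ∀ i, 0 ≤ w i) (v : EuclideanSpace ℝ (Fin K)) :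
    0 ≤ inner ℝ (Matrix.toEuclideanLin (wCov w x) v) v := by
  rw [inner_toEuclideanLin_wCov]
  exact Finset.sum_nonneg fun i _ => by
    rw [mul_assoc]; exact mul_nonneg (hw i) (mul_self_nonneg _)

lemma isSymmetric_wCov (w : Fin N → ℝ) : (Matrix.toEuclideanLin (wCov w x)).IsSymmetric := by
  intro v u
  rw [inner_toEuclideanLin_wCov, real_inner_comm, inner_toEuclideanLin_wCov]
  exact Finset.sum_congr rfl fun i _ => by ring

/-- With positive weights, zero variance makes `v` constant on the points. The constant value of
`inner ℝ v (x i - t)` has a sign, so `ht` applies to `v` or to `-v`. Here `ht` is the only form in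
which the relative interior condition is used. -/
lemma inner_eq_zero_of_wCov_inner_self {w : Fin N → ℝ} (hw : ∀ i, 0 < w i)
    (ht : ∀ v, (∀ i, inner ℝ v (x i - t) ≤ 0) → ∀ i, inner ℝ v (x i - t) = 0)
    {v : EuclideanSpace ℝ (Fin K)} (hv : inner ℝ (Matrix.toEuclideanLin (wCov w x) v) v = 0)
    (i : Fin N) : inner ℝ v (x i - t) = 0 := by
  rw [inner_toEuclideanLin_wCov, Finset.sum_eq_zero_iff_of_nonneg fun i _ => by
    rw [mul_assoc]; exact mul_nonneg (hw i).le (mul_self_nonneg _)] at hv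
  have h0 : ∀ i, inner ℝ (x i - wMean w x) v = 0 := fun i => by
    simpa [(hw i).ne'] using hv i (Finset.mem_univ i)
  have h1 : ∀ i, inner ℝ v (x i - t) = inner ℝ v (wMean w x - t) := fun i => by
    have := h0 i
    rw [real_inner_comm] at this
    rw [← sub_add_sub_cancel (x i) (wMean w x) t, inner_add_right, this, zero_add]
  rcases le_total (inner ℝ v (wMean w x - t)) 0 with h | h
  · exact ht v (fun i => (h1 i).trans_le h) i
  · have := ht (-v) (fun i => by rw [inner_neg_left, h1 i]; linarith) i
    simpa using this

/-- The bound is uniform in `θ` because every tilt is a probability vector and the deviations are at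
most `2 * D`. The added `1` keeps `Λ` positive when all points vanish. -/
lemma exists_wCov_bound [Nonempty (Fin N)] (hb : ∀ i, 0 < b i)
    (x : Fin N → EuclideanSpace ℝ (Fin K)) :
    ∃ Λ : ℝ, 0 < Λ ∧ ∀ θ v, ‖Matrix.toEuclideanLin (wCov (tilt b x θ) x) v‖ ≤ Λ * ‖v‖ := by
  set D := ∑ i, ‖x i‖
  have hD : ∀ i, ‖x i‖ ≤ D := fun i =>
    Finset.single_le_sum (f := fun i => ‖x i‖) (fun i _ => norm_nonneg _) (Finset.mem_univ i)
  refine ⟨(2 * D) ^ 2 + 1, by positivity, fun θ v => ?_⟩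
  have hw0 := fun i => (tilt_pos (x := x) hb θ i).le
  have hw1 := sum_tilt (x := x) hb θ
  have hμ : ‖wMean (tilt b x θ) x‖ ≤ D := by
    calc ‖wMean (tilt b x θ) x‖ ≤ ∑ i, tilt b x θ i * D :=
          norm_sum_le_of_le _ fun i _ => by
            rw [norm_smul, Real.norm_of_nonneg (hw0 i)]
            exact mul_le_mul_of_nonneg_left (hD i) (hw0 i)
      _ = D := by rw [← Finset.sum_mul, hw1, one_mul]
  have hd : ∀ i, ‖x i - wMean (tilt b x θ) x‖ ≤ 2 * D := fun i =>
    (norm_sub_le _ _).trans (by linarith [hD i])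
  rw [toEuclideanLin_wCov_apply]
  calc ‖∑ i, (tilt b x θ i * inner ℝ (x i - wMean (tilt b x θ) x) v) •
          (x i - wMean (tilt b x θ) x)‖
      ≤ ∑ i, tilt b x θ i * ((2 * D) ^ 2 * ‖v‖) := norm_sum_le_of_le _ fun i _ => by
        rw [norm_smul, norm_mul, Real.norm_of_nonneg (hw0 i), mul_assoc]
        refine mul_le_mul_of_nonneg_left ?_ (hw0 i)
        calc ‖inner ℝ (x i - wMean (tilt b x θ) x) v‖ * ‖x i - wMean (tilt b x θ) x‖
            ≤ (2 * D * ‖v‖) * (2 * D) := by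
              refine mul_le_mul ((norm_inner_le_norm _ _).trans ?_) (hd i) (norm_nonneg _)
                (mul_nonneg ((norm_nonneg _).trans (hd i)) (norm_nonneg _))
              exact mul_le_mul_of_nonneg_right (hd i) (norm_nonneg _)
          _ = (2 * D) ^ 2 * ‖v‖ := by ring
    _ ≤ ((2 * D) ^ 2 + 1) * ‖v‖ := by
        rw [← Finset.sum_mul, hw1]
        linarith [norm_nonneg v]

/-! ### Global smoothness and a sufficient condition for Armijo -/

lemma norm_dualResidual_sub_le [Nonempty (Fin N)] (hb : ∀ i, 0 < b i) {Λ : ℝ}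
    (hΛ : ∀ θ v, ‖Matrix.toEuclideanLin (wCov (tilt b x θ) x) v‖ ≤ Λ * ‖v‖) (hΛ0 : 0 ≤ Λ)
    (θ θ' : EuclideanSpace ℝ (Fin K)) :
    ‖dualResidual b x t θ' - dualResidual b x t θ‖ ≤ Λ * ‖θ' - θ‖ :=
  convex_univ.norm_image_sub_le_of_norm_hasFDerivWithin_le
    (fun θ _ => (hasFDerivAt_dualResidual hb θ).hasFDerivWithinAt)
    (fun θ _ => ContinuousLinearMap.opNorm_le_bound _ hΛ0 fun v => by simpa using hΛ θ v)
    (mem_univ _) (mem_univ _)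

lemma dualObj_add_ge [Nonempty (Fin N)] (hb : ∀ i, 0 < b i) {Λ : ℝ}
    (hΛ : ∀ θ v, ‖Matrix.toEuclideanLin (wCov (tilt b x θ) x) v‖ ≤ Λ * ‖v‖) (hΛ0 : 0 ≤ Λ)
    (θ d : EuclideanSpace ℝ (Fin K)) :
    dualObj b x t θ + inner ℝ (dualResidual b x t θ) d - Λ * ‖d‖ ^ 2 / 2 ≤
      dualObj b x t (θ + d) := by
  have h := add_sub_half_le_of_deriv_ge (p := inner ℝ (dualResidual b x t θ) d)
    (q := Λ * ‖d‖ ^ 2) (hasDerivAt_dualObj_line (x := x) (t := t) hb θ d) fun s hs => by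
      have h1 := norm_dualResidual_sub_le (t := t) hb hΛ hΛ0 θ (θ + s • d)
      rw [add_sub_cancel_left, norm_smul, Real.norm_of_nonneg hs.1.le] at h1
      have h2 := neg_le_of_abs_le (abs_real_inner_le_norm
        (dualResidual b x t (θ + s • d) - dualResidual b x t θ) d)
      have h3 := mul_le_mul_of_nonneg_right h1 (norm_nonneg d)
      rw [inner_sub_left] at h2
      nlinarith
  simpa using h

lemma armijo_of_mul_le [Nonempty (Fin N)] (hb : ∀ i, 0 < b i) {Λ : ℝ}
    (hΛ : ∀ θ v, ‖Matrix.toEuclideanLin (wCov (tilt b x θ) x) v‖ ≤ Λ * ‖v‖) (hΛ0 : 0 ≤ Λ)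
    {θ Δ : EuclideanSpace ℝ (Fin K)} {c α : ℝ} (hα : 0 ≤ α)
    (h : α * (Λ * ‖Δ‖ ^ 2) ≤ 2 * (1 - c) * inner ℝ (dualResidual b x t θ) Δ) :
    Armijo b x t c θ Δ α := by
  have h1 := dualObj_add_ge (t := t) hb hΛ hΛ0 θ (α • Δ)
  rw [inner_smul_right, norm_smul, Real.norm_of_nonneg hα] at h1
  have h2 := mul_le_mul_of_nonneg_left h hα
  unfold Armijo
  nlinarith

/-! ### Maximizers -/

/-- Concavity through `1 + u ≤ exp u`: at a critical point the linear terms average to zero, so the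
moment generating function is at least `1`. -/
lemma isMaxOn_of_dualResidual_eq_zero [Nonempty (Fin N)] (hb : ∀ i, 0 < b i)
    (h : dualResidual b x t θ = 0) : IsMaxOn (dualObj b x t) univ θ := by
  intro θ' _
  obtain ⟨d, rfl⟩ : ∃ d, θ' = θ + d := ⟨θ' - θ, by abel⟩
  have h0 := inner_dualResidual (x := x) (t := t) hb θ d
  rw [h, inner_zero_left] at h0
  have h1 : ∑ i, tilt b x θ i * (inner ℝ d (x i - t) + 1) ≤
      ∑ i, tilt b x θ i * Real.exp (inner ℝ d (x i - t)) :=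
    Finset.sum_le_sum fun i _ =>
      mul_le_mul_of_nonneg_left (Real.add_one_le_exp _) (tilt_pos hb θ i).le
  simp only [mul_add, Finset.sum_add_distrib, mul_one, sum_tilt hb] at h1
  have h2 := Real.log_nonneg (show 1 ≤ ∑ i, tilt b x θ i * Real.exp (inner ℝ d (x i - t)) by
    linarith)
  change dualObj b x t (θ + d) ≤ dualObj b x t θ
  rw [dualObj_add hb]
  linarith

lemma dualResidual_eq_zero_of_isMaxOn [Nonempty (Fin N)] (hb : ∀ i, 0 < b i)
    (h : IsMaxOn (dualObj b x t) univ θ) : dualResidual b x t θ = 0 := by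
  have := (h.isLocalMax univ_mem).hasFDerivAt_eq_zero (hasGradientAt_dualObj hb θ).hasFDerivAt
  simpa using this

/-- Two maximizers force equality in the averaged inequality `1 + u ≤ exp u`. Positive weights give
equality termwise, and strictness off `0` gives `u = 0`. -/
lemma inner_sub_eq_zero_of_isMaxOn [Nonempty (Fin N)] (hb : ∀ i, 0 < b i)
    (h : IsMaxOn (dualObj b x t) univ θ) (h' : IsMaxOn (dualObj b x t) univ θ') (i : Fin N) :
    inner ℝ (θ' - θ) (x i - t) = 0 := by
  obtain ⟨d, rfl⟩ : ∃ d, θ' = θ + d := ⟨θ' - θ, by abel⟩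
  rw [add_sub_cancel_left]
  have h0 := inner_dualResidual (x := x) (t := t) hb θ d
  rw [dualResidual_eq_zero_of_isMaxOn hb h, inner_zero_left] at h0
  have hle : dualObj b x t θ ≤ dualObj b x t (θ + d) := h' (mem_univ θ)
  rw [dualObj_add hb] at hle
  have h1 : ∑ i, tilt b x θ i * Real.exp (inner ℝ d (x i - t)) ≤ 1 := by
    rw [← Real.log_nonpos_iff (sum_tilt_mul_exp_pos hb θ _).le]
    linarith
  have hnn : ∀ i ∈ Finset.univ, 0 ≤ tilt b x θ i *
      (Real.exp (inner ℝ d (x i - t)) - (inner ℝ d (x i - t) + 1)) := fun i _ =>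
    mul_nonneg (tilt_pos hb θ i).le (sub_nonneg.2 (Real.add_one_le_exp _))
  have h2 : ∑ i, tilt b x θ i *
      (Real.exp (inner ℝ d (x i - t)) - (inner ℝ d (x i - t) + 1)) = 0 := by
    refine le_antisymm ?_ (Finset.sum_nonneg hnn)
    simp only [mul_add, mul_sub, Finset.sum_sub_distrib, Finset.sum_add_distrib, mul_one,
      sum_tilt hb]
    linarith
  have h3 := (Finset.sum_eq_zero_iff_of_nonneg hnn).1 h2 i (Finset.mem_univ i)
  by_contra hne
  have := mul_pos (tilt_pos (x := x) hb θ i) (sub_pos.2 (Real.add_one_lt_exp hne))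
  exact this.ne' h3

/-! ### Newton directions -/

lemma IsNewtonDir.inner_eq {δ : ℝ} {Δ : EuclideanSpace ℝ (Fin K)}
    (h : IsNewtonDir b x t δ θ Δ) :
    inner ℝ (dualResidual b x t θ) Δ =
      inner ℝ (Matrix.toEuclideanLin (wCov (tilt b x θ) x) Δ) Δ + δ * ‖Δ‖ ^ 2 := by
  rw [← h, toEuclideanLin_add_smul_one, inner_add_left, inner_smul_left, real_inner_self_eq_norm_sq]
  rfl

lemma IsNewtonDir.inner_nonneg [Nonempty (Fin N)] (hb : ∀ i, 0 < b i) {δ : ℝ} (hδ : 0 ≤ δ)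
    {Δ : EuclideanSpace ℝ (Fin K)} (h : IsNewtonDir b x t δ θ Δ) :
    0 ≤ inner ℝ (dualResidual b x t θ) Δ := by
  rw [h.inner_eq]
  have := wCov_inner_self_nonneg (x := x) (fun i => (tilt_pos (x := x) hb θ i).le) Δ
  positivity

/-- A symmetric operator has range equal to the orthogonal complement of its kernel. Kernel vectors
annihilate every `x i - t`, and `g` is a combination of these. -/
lemma exists_isNewtonDir [Nonempty (Fin N)] (hb : ∀ i, 0 < b i)
    (ht : ∀ v, (∀ i, inner ℝ v (x i - t) ≤ 0) → ∀ i, inner ℝ v (x i - t) = 0)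
    (θ : EuclideanSpace ℝ (Fin K)) {δ : ℝ} (hδ : 0 ≤ δ) : ∃ Δ, IsNewtonDir b x t δ θ Δ := by
  set A := Matrix.toEuclideanLin (wCov (tilt b x θ) x + δ • (1 : Matrix (Fin K) (Fin K) ℝ))
  have hA : A.IsSymmetric := by
    intro v u
    simp only [A, toEuclideanLin_add_smul_one, inner_add_left, inner_add_right, inner_smul_left,
      inner_smul_right, isSymmetric_wCov (x := x) (tilt b x θ) v u]
    rfl
  suffices h : dualResidual b x t θ ∈ LinearMap.range A from h
  rw [← Submodule.orthogonal_orthogonal (LinearMap.range A), hA.orthogonal_range,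
    Submodule.mem_orthogonal']
  intro v hv
  have hv' : inner ℝ (Matrix.toEuclideanLin (wCov (tilt b x θ) x) v) v + δ * ‖v‖ ^ 2 = 0 := by
    have := congrArg (fun y => inner ℝ y v) (LinearMap.mem_ker.1 hv)
    simpa only [A, toEuclideanLin_add_smul_one, inner_add_left, inner_smul_left,
      real_inner_self_eq_norm_sq, inner_zero_left, conj_trivial] using this
  have h1 := wCov_inner_self_nonneg (x := x) (fun i => (tilt_pos (x := x) hb θ i).le) v
  have h2 : 0 ≤ δ * ‖v‖ ^ 2 := by positivity
  have h3 := inner_eq_zero_of_wCov_inner_self (tilt_pos hb θ) ht (v := v) (by linarith)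
  rw [inner_dualResidual hb]
  simp [h3]

lemma exists_armijo [Nonempty (Fin N)] (hb : ∀ i, 0 < b i)
    (ht : ∀ v, (∀ i, inner ℝ v (x i - t) ≤ 0) → ∀ i, inner ℝ v (x i - t) = 0)
    {c β : ℝ} (hc : c < 1) (hβ0 : 0 < β) (hβ1 : β < 1) {δ : ℝ} (hδ : 0 ≤ δ)
    {Δ : EuclideanSpace ℝ (Fin K)} (h : IsNewtonDir b x t δ θ Δ) :
    ∃ j : ℕ, Armijo b x t c θ Δ (β ^ j) := by
  obtain ⟨Λ, hΛ0, hΛ⟩ := exists_wCov_bound hb x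
  rcases (h.inner_nonneg hb hδ).eq_or_lt with h0 | h0
  -- If `gᵀΔ = 0`, then `Δ` is a direction of invariance of `L`, so the full step gives equality in
  -- Armijo.
  · refine ⟨0, ?_⟩
    have h1 := wCov_inner_self_nonneg (x := x) (fun i => (tilt_pos (x := x) hb θ i).le) Δ
    have h2 : 0 ≤ δ * ‖Δ‖ ^ 2 := by positivity
    have h3 := h.inner_eq
    have h4 := inner_eq_zero_of_wCov_inner_self (tilt_pos hb θ) ht (v := Δ) (by linarith)
    simp [Armijo, ← h0, dualObj_add_of_inner_eq_zero hb θ h4]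
  · have hc' : 0 < 2 * (1 - c) := by linarith
    have hD : 0 < Λ * ‖Δ‖ ^ 2 + 1 := by positivity
    obtain ⟨j, hj⟩ := exists_pow_lt_of_lt_one (div_pos (mul_pos hc' h0) hD) hβ1
    refine ⟨j, armijo_of_mul_le hb hΛ hΛ0.le (pow_pos hβ0 j).le ?_⟩
    rw [lt_div_iff₀ hD] at hj
    have := pow_pos hβ0 j
    nlinarith

/-! ### Reduction to the span of the centred points -/

/-- The span of the centred points, i.e. the direction of the affine hull of the points when `t`
lies in it. -/
def centredSpan {N K : ℕ} (x : Fin N → EuclideanSpace ℝ (Fin K)) (t : EuclideanSpace ℝ (Fin K)) :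
    Submodule ℝ (EuclideanSpace ℝ (Fin K)) :=
  Submodule.span ℝ (range fun i => x i - t)

lemma sub_mem_centredSpan (i : Fin N) : x i - t ∈ centredSpan x t :=
  Submodule.subset_span (mem_range_self i)

lemma mem_orthogonal_centredSpan {v : EuclideanSpace ℝ (Fin K)} :
    v ∈ (centredSpan x t)ᗮ ↔ ∀ i, inner ℝ v (x i - t) = 0 := by
  rw [Submodule.mem_orthogonal']
  refine ⟨fun h i => h _ (sub_mem_centredSpan i), fun h u hu => ?_⟩
  have : centredSpan x t ≤ LinearMap.ker (innerₛₗ ℝ v) :=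
    Submodule.span_le.2 (by rintro _ ⟨i, rfl⟩; simpa using h i)
  simpa using this hu

lemma inner_sub_starProjection (v : EuclideanSpace ℝ (Fin K)) (i : Fin N) :
    inner ℝ (v - (centredSpan x t).starProjection v) (x i - t) = 0 :=
  Submodule.starProjection_inner_eq_zero _ _ (sub_mem_centredSpan i)

lemma eq_zero_of_mem_centredSpan {v : EuclideanSpace ℝ (Fin K)} (hv : v ∈ centredSpan x t)
    (h : ∀ i, inner ℝ v (x i - t) = 0) : v = 0 :=
  inner_self_eq_zero.1 (Submodule.inner_left_of_mem_orthogonal hv (mem_orthogonal_centredSpan.2 h))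

lemma sub_wMean_mem_centredSpan {w : Fin N → ℝ} (hw : ∑ i, w i = 1) :
    t - wMean w x ∈ centredSpan x t := by
  rw [← neg_sub, ← sum_smul_sub hw]
  exact neg_mem (Submodule.sum_mem _ fun i _ => Submodule.smul_mem _ _ (sub_mem_centredSpan i))

lemma wCov_apply_mem_centredSpan {w : Fin N → ℝ} (hw : ∑ i, w i = 1)
    (v : EuclideanSpace ℝ (Fin K)) : Matrix.toEuclideanLin (wCov w x) v ∈ centredSpan x t := by
  rw [toEuclideanLin_wCov_apply]
  refine Submodule.sum_mem _ fun i _ => Submodule.smul_mem _ _ ?_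
  rw [← sub_add_sub_cancel (x i) t]
  exact add_mem (sub_mem_centredSpan i) (sub_wMean_mem_centredSpan hw)

lemma dualObj_starProjection [Nonempty (Fin N)] (hb : ∀ i, 0 < b i)
    (θ : EuclideanSpace ℝ (Fin K)) :
    dualObj b x t ((centredSpan x t).starProjection θ) = dualObj b x t θ := by
  rw [← dualObj_add_of_inner_eq_zero hb _ (inner_sub_starProjection θ), add_sub_cancel]

lemma tilt_starProjection [Nonempty (Fin N)] (hb : ∀ i, 0 < b i)
    (θ : EuclideanSpace ℝ (Fin K)) :
    tilt b x ((centredSpan x t).starProjection θ) = tilt b x θ := by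
  rw [← tilt_add_of_inner_eq_zero hb _ (inner_sub_starProjection (t := t) θ), add_sub_cancel]

lemma dualResidual_starProjection [Nonempty (Fin N)] (hb : ∀ i, 0 < b i)
    (θ : EuclideanSpace ℝ (Fin K)) :
    dualResidual b x t ((centredSpan x t).starProjection θ) = dualResidual b x t θ := by
  rw [dualResidual, tilt_starProjection hb, dualResidual]

lemma dualResidual_mem_centredSpan [Nonempty (Fin N)] (hb : ∀ i, 0 < b i)
    (θ : EuclideanSpace ℝ (Fin K)) : dualResidual b x t θ ∈ centredSpan x t :=
  sub_wMean_mem_centredSpan (sum_tilt hb θ)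

lemma IsNewtonDir.starProjection [Nonempty (Fin N)] (hb : ∀ i, 0 < b i) {δ : ℝ}
    {Δ : EuclideanSpace ℝ (Fin K)} (h : IsNewtonDir b x t δ θ Δ) :
    IsNewtonDir b x t δ ((centredSpan x t).starProjection θ)
      ((centredSpan x t).starProjection Δ) := by
  unfold IsNewtonDir at h ⊢
  rw [toEuclideanLin_add_smul_one] at h ⊢
  have h1 : Matrix.toEuclideanLin (wCov (tilt b x θ) x) ((centredSpan x t).starProjection Δ) =
      Matrix.toEuclideanLin (wCov (tilt b x θ) x) Δ := by
    have := wCov_apply_eq_zero (sum_tilt (x := x) hb θ) (inner_sub_starProjection (x := x) (t := t) Δ)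
    rw [map_sub, sub_eq_zero] at this
    exact this.symm
  -- `δ • Δ` is the difference of `g` and `ΣΔ`, both in the span, so the ridge term survives
  -- projection whether or not `δ = 0`.
  have h2 : δ • Δ ∈ centredSpan x t := by
    rw [← eq_sub_iff_add_eq'] at h
    rw [h]
    exact sub_mem (dualResidual_mem_centredSpan hb θ)
      (wCov_apply_mem_centredSpan (sum_tilt hb θ) Δ)
  rw [tilt_starProjection hb, dualResidual_starProjection hb, h1, ← map_smul,
    Submodule.starProjection_eq_self_iff.2 h2, h]

lemma armijo_starProjection_iff [Nonempty (Fin N)] (hb : ∀ i, 0 < b i) {c α : ℝ}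
    {Δ : EuclideanSpace ℝ (Fin K)} :
    Armijo b x t c ((centredSpan x t).starProjection θ) ((centredSpan x t).starProjection Δ) α ↔
      Armijo b x t c θ Δ α := by
  have h1 : inner ℝ (dualResidual b x t θ) ((centredSpan x t).starProjection Δ) =
      inner ℝ (dualResidual b x t θ) Δ := by
    rw [← Submodule.inner_starProjection_left_eq_right, Submodule.starProjection_eq_self_iff.2
      (dualResidual_mem_centredSpan hb θ)]
  rw [Armijo, Armijo, ← map_smul, ← map_add, dualObj_starProjection hb, dualObj_starProjection hb,
    dualResidual_starProjection hb, h1]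

lemma IsNewtonRun.starProjection [Nonempty (Fin N)] (hb : ∀ i, 0 < b i) {c β : ℝ} {δ : ℕ → ℝ}
    {θ Δ : ℕ → EuclideanSpace ℝ (Fin K)} {n : ℕ → ℕ} (h : IsNewtonRun b x t c β δ θ Δ n) :
    IsNewtonRun b x t c β δ (fun k => (centredSpan x t).starProjection (θ k))
      (fun k => (centredSpan x t).starProjection (Δ k)) n where
  dir k := (h.dir k).starProjection hb
  search k := by simpa only [armijo_starProjection_iff hb] using h.search k
  step k := by rw [h.step k, map_add, map_smul]

/-! ### Compactness of level sets and existence of a maximizer -/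

/-- Minimize over the compact product of `C` with the unit sphere of `V`, then scale. It is used
with `p = 1` for compactness of superlevel sets and `p = 2` for the covariance. -/
lemma exists_pos_mul_norm_le (V : Submodule ℝ (EuclideanSpace ℝ (Fin K)))
    {X : Type*} [TopologicalSpace X] {C : Set X} (hC : IsCompact C) (p : ℕ)
    (f : X → EuclideanSpace ℝ (Fin K) → ℝ) (hf : Continuous fun z : X × _ => f z.1 z.2)
    (hpos : ∀ y ∈ C, ∀ v ∈ V, v ≠ 0 → 0 < f y v)
    (hhom : ∀ y v, ∀ r : ℝ, 0 ≤ r → f y (r • v) = r ^ p * f y v) :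
    ∃ κ : ℝ, 0 < κ ∧ ∀ y ∈ C, ∀ v ∈ V, v ≠ 0 → κ * ‖v‖ ^ p ≤ f y v := by
  have hK : IsCompact (C ×ˢ (Metric.sphere (0 : EuclideanSpace ℝ (Fin K)) 1 ∩ V)) :=
    hC.prod ((isCompact_sphere _ _).inter_right V.closed_of_finiteDimensional)
  obtain ⟨κ, hκ, hle⟩ : ∃ κ : ℝ, 0 < κ ∧
      ∀ z ∈ C ×ˢ (Metric.sphere (0 : EuclideanSpace ℝ (Fin K)) 1 ∩ V), κ ≤ f z.1 z.2 :=
    hK.exists_forall_le' hf.continuousOn fun z hz => by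
      refine hpos _ hz.1 _ hz.2.2 fun h0 => ?_
      have := hz.2.1
      rw [h0] at this
      simp at this
  refine ⟨κ, hκ, fun y hy v hv hv0 => ?_⟩
  have hn := norm_pos_iff.2 hv0
  have h1 := hle (y, ‖v‖⁻¹ • v) ⟨hy, by simp [norm_smul, hn.ne'], V.smul_mem _ hv⟩
  have h2 := hhom y (‖v‖⁻¹ • v) ‖v‖ hn.le
  rw [smul_smul, mul_inv_cancel₀ hn.ne', one_smul] at h2
  rw [h2, mul_comm]
  exact mul_le_mul_of_nonneg_left h1 (by positivity)

/-- Since `exp u ≥ max u 0`, the centred partition function grows at least linearly on the span. The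
radius comes from `κ ‖θ‖ ≤ ∑ i, b i * exp (inner ℝ θ (x i - t)) ≤ exp (-l)`. -/
lemma isCompact_superlevel [Nonempty (Fin N)] (hb : ∀ i, 0 < b i) (hb1 : ∑ i, b i = 1)
    (ht : ∀ v, (∀ i, inner ℝ v (x i - t) ≤ 0) → ∀ i, inner ℝ v (x i - t) = 0) (l : ℝ) :
    IsCompact {θ | θ ∈ centredSpan x t ∧ l ≤ dualObj b x t θ} := by
  obtain ⟨κ, hκ, hle⟩ := exists_pos_mul_norm_le (centredSpan x t) (isCompact_singleton (x := ())) 1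
    (fun _ v => ∑ i, b i * max (inner ℝ v (x i - t)) 0) (by fun_prop)
    (fun _ _ v hv hv0 => by
      refine lt_of_le_of_ne (Finset.sum_nonneg fun i _ =>
        mul_nonneg (hb i).le (le_max_right _ _)) fun h0 => hv0 ?_
      refine eq_zero_of_mem_centredSpan hv (ht v fun i => ?_)
      have := (Finset.sum_eq_zero_iff_of_nonneg fun i _ =>
        mul_nonneg (hb i).le (le_max_right _ _)).1 h0.symm i (Finset.mem_univ i)
      rw [← (mul_eq_zero.1 this).resolve_left (hb i).ne']
      exact le_max_left _ _)
    (fun _ v r hr => by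
      rw [pow_one, Finset.mul_sum]
      refine Finset.sum_congr rfl fun i _ => ?_
      rw [inner_smul_left, conj_trivial, mul_left_comm, mul_max_of_nonneg _ _ hr, mul_zero])
  refine (isCompact_closedBall (0 : EuclideanSpace ℝ (Fin K)) (Real.exp (-l) / κ)).of_isClosed_subset
    ((centredSpan x t).closed_of_finiteDimensional.inter
      (isClosed_le continuous_const (continuous_dualObj hb))) ?_
  rintro θ ⟨hθ, hl⟩
  rw [mem_closedBall_zero_iff, le_div_iff₀ hκ]
  rcases eq_or_ne θ 0 with rfl | h0
  · rw [norm_zero, zero_mul]; positivity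
  have h1 := hle () (mem_singleton _) θ hθ h0
  have h2 : ∑ i, b i * max (inner ℝ θ (x i - t)) 0 ≤
      ∑ i, b i * Real.exp (inner ℝ θ (x i - t)) :=
    Finset.sum_le_sum fun i _ => mul_le_mul_of_nonneg_left
      (max_le (by linarith [Real.add_one_le_exp (inner ℝ θ (x i - t))]) (Real.exp_pos _).le)
      (hb i).le
  have hpos : 0 < ∑ i, b i * Real.exp (inner ℝ θ (x i - t)) :=
    Finset.sum_pos (fun i _ => mul_pos (hb i) (Real.exp_pos _)) Finset.univ_nonempty
  rw [dualObj_eq_neg_log hb hb1, le_neg, Real.log_le_iff_le_exp hpos] at hl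
  rw [pow_one] at h1
  linarith

lemma exists_isMaxOn_dualObj [Nonempty (Fin N)] (hb : ∀ i, 0 < b i) (hb1 : ∑ i, b i = 1)
    (ht : ∀ v, (∀ i, inner ℝ v (x i - t) ≤ 0) → ∀ i, inner ℝ v (x i - t) = 0) :
    ∃ θs ∈ centredSpan x t, IsMaxOn (dualObj b x t) univ θs := by
  obtain ⟨θs, hs, hmax⟩ := (isCompact_superlevel hb hb1 ht (dualObj b x t 0)).exists_isMaxOn
    ⟨0, zero_mem _, le_rfl⟩ (continuous_dualObj hb).continuousOn
  refine ⟨θs, hs.1, fun θ _ => ?_⟩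
  change dualObj b x t θ ≤ dualObj b x t θs
  rw [← dualObj_starProjection hb θ]
  rcases le_total (dualObj b x t 0) (dualObj b x t ((centredSpan x t).starProjection θ)) with h | h
  · exact hmax ⟨Submodule.starProjection_apply_mem _ _, h⟩
  · exact h.trans hs.2

lemma exists_wCov_coercive [Nonempty (Fin N)] (hb : ∀ i, 0 < b i)
    (ht : ∀ v, (∀ i, inner ℝ v (x i - t) ≤ 0) → ∀ i, inner ℝ v (x i - t) = 0)
    {C : Set (EuclideanSpace ℝ (Fin K))} (hC : IsCompact C) :
    ∃ m : ℝ, 0 < m ∧ ∀ θ ∈ C, ∀ v ∈ centredSpan x t,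
      m * ‖v‖ ^ 2 ≤ inner ℝ (Matrix.toEuclideanLin (wCov (tilt b x θ) x) v) v := by
  have hw : ∀ i, Continuous fun z : EuclideanSpace ℝ (Fin K) × EuclideanSpace ℝ (Fin K) =>
      tilt b x z.1 i := fun i =>
    (continuous_apply i).comp ((continuous_tilt hb).comp continuous_fst)
  obtain ⟨m, hm, hle⟩ := exists_pos_mul_norm_le (centredSpan x t) hC 2
    (fun θ v => inner ℝ (Matrix.toEuclideanLin (wCov (tilt b x θ) x) v) v)
    (by
      simp_rw [inner_toEuclideanLin_wCov, wMean]
      fun_prop)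
    (fun θ _ v hv hv0 => (wCov_inner_self_nonneg (fun i => (tilt_pos hb θ i).le) v).lt_of_ne
      fun h0 => hv0 (eq_zero_of_mem_centredSpan hv
        (inner_eq_zero_of_wCov_inner_self (tilt_pos hb θ) ht h0.symm)))
    (fun θ v r _ => by
      rw [map_smul, inner_smul_left, inner_smul_right, conj_trivial]; ring)
  refine ⟨m, hm, fun θ hθ v hv => ?_⟩
  rcases eq_or_ne v 0 with rfl | hv0
  · simp
  · exact hle θ hθ v hv hv0

/-! ### Global convergence -/

lemma IsNewtonRun.monotone [Nonempty (Fin N)] (hb : ∀ i, 0 < b i) {c β : ℝ} (hc : 0 < c)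
    (hβ : 0 < β) {δ : ℕ → ℝ} (hδ : ∀ k, 0 ≤ δ k) {θ Δ : ℕ → EuclideanSpace ℝ (Fin K)} {n : ℕ → ℕ}
    (h : IsNewtonRun b x t c β δ θ Δ n) : Monotone fun k => dualObj b x t (θ k) := by
  refine monotone_nat_of_le_succ fun k => ?_
  have h1 : Armijo b x t c (θ k) (Δ k) (β ^ n k) := (h.search k).1
  rw [Armijo, ← h.step k] at h1
  have h2 := (h.dir k).inner_nonneg hb (hδ k)
  have h3 := pow_pos hβ (n k)
  have : 0 ≤ c * β ^ n k * inner ℝ (dualResidual b x t (θ k)) (Δ k) := by positivity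
  linarith

/-- Every step of size at most `2 * (1 - c) * m / Λ` passes Armijo. Unless the full step was taken,
the last rejected step was larger, and the accepted one is `β` times it. -/
lemma min_le_pow_of_isLeast_armijo [Nonempty (Fin N)] (hb : ∀ i, 0 < b i) {Λ : ℝ}
    (hΛ : ∀ θ v, ‖Matrix.toEuclideanLin (wCov (tilt b x θ) x) v‖ ≤ Λ * ‖v‖) (hΛ0 : 0 < Λ)
    {Δ : EuclideanSpace ℝ (Fin K)} {c β m : ℝ} (hc : c < 1) (hβ : 0 < β)
    (hm : m * ‖Δ‖ ^ 2 ≤ inner ℝ (dualResidual b x t θ) Δ) {n : ℕ}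
    (hn : IsLeast {j : ℕ | Armijo b x t c θ Δ (β ^ j)} n) :
    min 1 (β * (2 * (1 - c) * m / Λ)) ≤ β ^ n := by
  rcases n with _ | n
  · simp
  refine (min_le_right _ _).trans ?_
  rw [pow_succ']
  refine mul_le_mul_of_nonneg_left ?_ hβ.le
  by_contra! hlt
  have hA : Armijo b x t c θ Δ (β ^ n) := by
    refine armijo_of_mul_le hb hΛ hΛ0.le (pow_pos hβ n).le ?_
    have h1 := (lt_div_iff₀ hΛ0).1 hlt
    calc β ^ n * (Λ * ‖Δ‖ ^ 2) = β ^ n * Λ * ‖Δ‖ ^ 2 := by ring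
      _ ≤ 2 * (1 - c) * m * ‖Δ‖ ^ 2 := mul_le_mul_of_nonneg_right h1.le (by positivity)
      _ = 2 * (1 - c) * (m * ‖Δ‖ ^ 2) := by ring
      _ ≤ _ := mul_le_mul_of_nonneg_left hm (by linarith)
  have := hn.2 hA
  omega

lemma IsNewtonDir.norm_dualResidual_le {Λ : ℝ}
    (hΛ : ∀ θ v, ‖Matrix.toEuclideanLin (wCov (tilt b x θ) x) v‖ ≤ Λ * ‖v‖)
    {δ : ℝ} (hδ : 0 ≤ δ) {Δ : EuclideanSpace ℝ (Fin K)} (h : IsNewtonDir b x t δ θ Δ) :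
    ‖dualResidual b x t θ‖ ≤ (Λ + δ) * ‖Δ‖ := by
  rw [← h, toEuclideanLin_add_smul_one, add_mul]
  refine (norm_add_le _ _).trans (add_le_add (hΛ θ Δ) ?_)
  rw [norm_smul, Real.norm_of_nonneg hδ]

/-- A run inside the span of the centred points converges to a maximizer. -/
lemma IsNewtonRun.tendsto_of_mem_centredSpan [Nonempty (Fin N)] (hb : ∀ i, 0 < b i)
    (hb1 : ∑ i, b i = 1)
    (ht : ∀ v, (∀ i, inner ℝ v (x i - t) ≤ 0) → ∀ i, inner ℝ v (x i - t) = 0)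
    {c β : ℝ} (hc0 : 0 < c) (hc1 : c < 1) (hβ : 0 < β) {δ : ℕ → ℝ} {δmax : ℝ}
    (hδ : ∀ k, 0 ≤ δ k ∧ δ k ≤ δmax) {θ Δ : ℕ → EuclideanSpace ℝ (Fin K)} {n : ℕ → ℕ}
    (h : IsNewtonRun b x t c β δ θ Δ n) (hθ : ∀ k, θ k ∈ centredSpan x t)
    (hΔ : ∀ k, Δ k ∈ centredSpan x t) {θs : EuclideanSpace ℝ (Fin K)}
    (hs : θs ∈ centredSpan x t) (hmax : IsMaxOn (dualObj b x t) univ θs) :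
    Tendsto θ atTop (𝓝 θs) := by
  obtain ⟨Λ, hΛ0, hΛ⟩ := exists_wCov_bound hb x
  have hmono := h.monotone hb hc0 hβ fun k => (hδ k).1
  have hC := isCompact_superlevel hb hb1 ht (dualObj b x t (θ 0))
  have hmem : ∀ k, θ k ∈ {θ' | θ' ∈ centredSpan x t ∧ dualObj b x t (θ 0) ≤ dualObj b x t θ'} :=
    fun k => ⟨hθ k, hmono (Nat.zero_le k)⟩
  obtain ⟨m, hm, hcoer⟩ := exists_wCov_coercive hb ht hC
  set a := min 1 (β * (2 * (1 - c) * m / Λ)) with ha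
  have ha0 : 0 < a := by
    have : 0 < 1 - c := by linarith
    exact lt_min one_pos (by positivity)
  have hinner : ∀ k, m * ‖Δ k‖ ^ 2 ≤ inner ℝ (dualResidual b x t (θ k)) (Δ k) := fun k => by
    rw [(h.dir k).inner_eq]
    have h1 := hcoer _ (hmem k) _ (hΔ k)
    have h2 : 0 ≤ δ k * ‖Δ k‖ ^ 2 := mul_nonneg (hδ k).1 (by positivity)
    linarith
  have hinc : ∀ k, (c * a * m) * ‖Δ k‖ ^ 2 ≤ dualObj b x t (θ (k + 1)) - dualObj b x t (θ k) :=
    fun k => by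
      have h1 : Armijo b x t c (θ k) (Δ k) (β ^ n k) := (h.search k).1
      rw [Armijo, ← h.step k] at h1
      have h2 : a ≤ β ^ n k :=
        min_le_pow_of_isLeast_armijo hb hΛ hΛ0 hc1 hβ (hinner k) (h.search k)
      have h3 : c * a * (m * ‖Δ k‖ ^ 2) ≤
          c * β ^ n k * inner ℝ (dualResidual b x t (θ k)) (Δ k) :=
        mul_le_mul (mul_le_mul_of_nonneg_left h2 hc0.le) (hinner k) (by positivity) (by positivity)
      linarith
  have hconv : Tendsto (fun k => dualObj b x t (θ k)) atTop
      (𝓝 (⨆ k, dualObj b x t (θ k))) :=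
    tendsto_atTop_ciSup hmono ⟨dualObj b x t θs, by rintro _ ⟨k, rfl⟩; exact hmax (mem_univ _)⟩
  -- The increments of a convergent sequence tend to zero, and they dominate a fixed multiple of `‖Δ
  -- k‖²`.
  have hΔ0 : Tendsto (fun k => ‖Δ k‖) atTop (𝓝 0) := by
    have h1 := ((tendsto_add_atTop_iff_nat 1).2 hconv).sub hconv
    rw [sub_self] at h1
    have h2 := squeeze_zero (fun k => by positivity) hinc h1
    have h3 := (h2.const_mul (c * a * m)⁻¹).sqrt
    have h4 : c * a * m ≠ 0 := by positivity
    rw [mul_zero, Real.sqrt_zero] at h3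
    exact h3.congr fun k => by rw [inv_mul_cancel_left₀ h4, Real.sqrt_sq (norm_nonneg _)]
  have hg0 : Tendsto (fun k => dualResidual b x t (θ k)) atTop (𝓝 0) := by
    refine squeeze_zero_norm (fun k => ?_) (by simpa using hΔ0.const_mul (Λ + δmax))
    refine ((h.dir k).norm_dualResidual_le hΛ (hδ k).1).trans ?_
    exact mul_le_mul_of_nonneg_right (by linarith [(hδ k).2]) (norm_nonneg _)
  -- In a compact set it suffices that every cluster point is `θs`: it is critical, hence a
  -- maximizer, and the span contains only one.
  refine hC.tendsto_nhds_of_unique_mapClusterPt (Eventually.of_forall hmem) fun y hy hcl => ?_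
  obtain ⟨ψ, hψ, hlim⟩ := hcl.tendsto_subseq
  have hgy : dualResidual b x t y = 0 :=
    tendsto_nhds_unique (((continuous_dualResidual hb).tendsto y).comp hlim)
      (hg0.comp hψ.tendsto_atTop)
  have := eq_zero_of_mem_centredSpan (sub_mem hy.1 hs)
    (inner_sub_eq_zero_of_isMaxOn hb hmax (isMaxOn_of_dualResidual_eq_zero hb hgy))
  exact sub_eq_zero.1 this

/-! ### Local quadratic convergence -/

/-- First-order Taylor estimate for a map with Lipschitz derivative. -/
lemma norm_sub_sub_fderiv_le {E F : Type*} [NormedAddCommGroup E] [NormedSpace ℝ E]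
    [NormedAddCommGroup F] [NormedSpace ℝ F] {f : E → F} (hf : Differentiable ℝ f) {s : Set E}
    (hs : Convex ℝ s) {M : ℝ≥0} (hM : LipschitzOnWith M (fderiv ℝ f) s) {y d : E} (hy : y ∈ s)
    (hyd : y + d ∈ s) : ‖f (y + d) - f y - fderiv ℝ f y d‖ ≤ M / 2 * ‖d‖ ^ 2 := by
  have hseg : ∀ r ∈ Icc (0 : ℝ) 1, y + r • d ∈ s := fun r hr => by
    have := hs.add_smul_sub_mem hy hyd hr
    rwa [add_sub_cancel_left] at this
  have hline : ∀ r : ℝ, HasDerivAt (fun r : ℝ => y + r • d) d r := fun r => by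
    simpa using ((hasDerivAt_id r).smul_const d).const_add y
  have hder : ∀ r : ℝ, HasDerivAt (fun r : ℝ => f (y + r • d) - f y - r • fderiv ℝ f y d)
      (fderiv ℝ f (y + r • d) d - fderiv ℝ f y d) r := fun r => by
    have h1 := (hf (y + r • d)).hasFDerivAt.comp_hasDerivAt r (hline r)
    have h2 := (hasDerivAt_id r).smul_const (fderiv ℝ f y d)
    rw [one_smul] at h2
    exact (h1.sub_const (f y)).sub h2
  have hB : ∀ r : ℝ, HasDerivAt (fun r : ℝ => M / 2 * ‖d‖ ^ 2 * r ^ 2) (M * ‖d‖ ^ 2 * r) r :=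
    fun r => by
      refine ((hasDerivAt_pow 2 r).const_mul (M / 2 * ‖d‖ ^ 2)).congr_deriv ?_
      norm_num
      ring
  have h := image_norm_le_of_norm_deriv_right_le_deriv_boundary (a := 0) (b := 1)
    (fun r _ => (hder r).continuousAt.continuousWithinAt)
    (fun r _ => (hder r).hasDerivWithinAt) (by simp) hB (fun r hr => by
      rw [← _root_.sub_apply]
      refine (ContinuousLinearMap.le_opNorm _ _).trans ?_
      have h1 := hM.dist_le_mul _ (hseg r ⟨hr.1, hr.2.le⟩) _ hy
      rw [dist_eq_norm, dist_eq_norm, add_sub_cancel_left, norm_smul,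
        Real.norm_of_nonneg hr.1] at h1
      calc _ ≤ M * (r * ‖d‖) * ‖d‖ := mul_le_mul_of_nonneg_right h1 (norm_nonneg _)
        _ = M * ‖d‖ ^ 2 * r := by ring) (right_mem_Icc.2 zero_le_one)
  simpa using h

lemma mul_norm_sq_le_of_posSemidef {A : Matrix (Fin K) (Fin K) ℝ} {m : ℝ}
    (h : (A - m • (1 : Matrix (Fin K) (Fin K) ℝ)).PosSemidef) (v : EuclideanSpace ℝ (Fin K)) :
    m * ‖v‖ ^ 2 ≤ inner ℝ (Matrix.toEuclideanLin A v) v := by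
  have h1 := (Matrix.isPositive_toEuclideanLin_iff.2 h).inner_nonneg_left v
  rw [sub_eq_add_neg, ← neg_smul, toEuclideanLin_add_smul_one, inner_add_left, inner_smul_left,
    real_inner_self_eq_norm_sq, conj_trivial] at h1
  linarith

lemma mul_norm_le_of_mul_norm_sq_le {E : Type*} [NormedAddCommGroup E] [InnerProductSpace ℝ E]
    {m : ℝ} {v y : E} (h : m * ‖v‖ ^ 2 ≤ inner ℝ y v) : m * ‖v‖ ≤ ‖y‖ := by
  rcases (norm_nonneg v).eq_or_lt with h0 | h0
  · rw [← h0, mul_zero]; exact norm_nonneg _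
  · refine le_of_mul_le_mul_right ?_ h0
    calc m * ‖v‖ * ‖v‖ = m * ‖v‖ ^ 2 := by ring
      _ ≤ _ := h.trans (real_inner_le_norm _ _)

lemma differentiable_gradient_dualObj [Nonempty (Fin N)] (hb : ∀ i, 0 < b i) :
    Differentiable ℝ (∇ (dualObj b x t)) := by
  rw [gradient_dualObj hb]
  exact fun θ => (hasFDerivAt_dualResidual hb θ).differentiableAt

/-- A full Newton step from a point near a maximizer satisfies the quadratic estimate. -/
lemma IsNewtonDir.norm_add_sub_le [Nonempty (Fin N)] (hb : ∀ i, 0 < b i) {s : Set _}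
    (hs : Convex ℝ s) {m : ℝ} (hm : 0 < m)
    (hpos : ∀ θ ∈ s, ∀ v, m * ‖v‖ ^ 2 ≤
      inner ℝ (Matrix.toEuclideanLin (wCov (tilt b x θ) x) v) v) {M : ℝ≥0}
    (hM : LipschitzOnWith M (fderiv ℝ (∇ (dualObj b x t))) s)
    (hmax : IsMaxOn (dualObj b x t) univ θs) (hθs : θs ∈ s) (hθ : θ ∈ s)
    {Δ : EuclideanSpace ℝ (Fin K)} (h : IsNewtonDir b x t 0 θ Δ) :
    ‖θ + Δ - θs‖ ≤ M / (2 * m) * ‖θ - θs‖ ^ 2 := by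
  -- Expand `g` from `θ` towards `θs`. With `g θs = 0` and `g θ = ΣΔ`, the remainder is exactly `Σ
  -- (θs - θ - Δ)`, and coercivity inverts `Σ`.
  have h1 := norm_sub_sub_fderiv_le (differentiable_gradient_dualObj hb) hs hM (y := θ)
    (d := θs - θ) hθ (by rwa [add_sub_cancel])
  rw [fderiv_gradient_dualObj hb, gradient_dualObj hb, add_sub_cancel,
    dualResidual_eq_zero_of_isMaxOn hb hmax, ← h, toEuclideanLin_add_smul_one, zero_smul, add_zero,
    zero_sub, sub_neg_eq_add, neg_add_eq_sub, ← map_sub, norm_sub_rev θs θ, ← norm_neg,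
    ← map_neg] at h1
  have h2 := (mul_norm_le_of_mul_norm_sq_le (hpos θ hθ _)).trans h1
  rw [show -(θs - θ - Δ) = θ + Δ - θs by abel] at h2
  calc ‖θ + Δ - θs‖ ≤ (M / 2 * ‖θ - θs‖ ^ 2) / m := (le_div_iff₀' hm).2 h2
    _ = M / (2 * m) * ‖θ - θs‖ ^ 2 := by field_simp

/-- The full Newton step satisfies the Armijo condition when it is short. -/
lemma IsNewtonDir.armijo_one [Nonempty (Fin N)] (hb : ∀ i, 0 < b i)
    {s : Set (EuclideanSpace ℝ (Fin K))} (hs : Convex ℝ s) {m : ℝ}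
    (hpos : ∀ θ ∈ s, ∀ v, m * ‖v‖ ^ 2 ≤
      inner ℝ (Matrix.toEuclideanLin (wCov (tilt b x θ) x) v) v) {M : ℝ≥0}
    (hM : LipschitzOnWith M (fderiv ℝ (∇ (dualObj b x t))) s) (hθ : θ ∈ s)
    {Δ : EuclideanSpace ℝ (Fin K)} (hθΔ : θ + Δ ∈ s) (h : IsNewtonDir b x t 0 θ Δ) {c : ℝ}
    (hc : c ≤ 1 / 2) (hΔ : M / 2 * ‖Δ‖ ≤ (1 / 2 - c) * m) : Armijo b x t c θ Δ 1 := by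
  have hinner := h.inner_eq
  rw [zero_mul, add_zero] at hinner
  have hseg : ∀ r ∈ Ioo (0 : ℝ) 1, θ + r • Δ ∈ s := fun r hr => by
    have := hs.add_smul_sub_mem hθ hθΔ ⟨hr.1.le, hr.2.le⟩
    rwa [add_sub_cancel_left] at this
  -- The slope at `r` is at least `(1 - r) gᵀΔ` minus a cubic error, so the full step gains at least
  -- `gᵀΔ / 2 - M / 2 * ‖Δ‖ ^ 3`.
  have h1 := add_sub_half_le_of_deriv_ge
    (p := inner ℝ (dualResidual b x t θ) Δ - M / 2 * ‖Δ‖ ^ 3)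
    (q := inner ℝ (dualResidual b x t θ) Δ)
    (hasDerivAt_dualObj_line (x := x) (t := t) hb θ Δ) fun r hr => by
      have h2 := norm_sub_sub_fderiv_le (differentiable_gradient_dualObj hb) hs hM hθ (hseg r hr)
      rw [fderiv_gradient_dualObj hb, gradient_dualObj hb, norm_smul,
        Real.norm_of_nonneg hr.1.le, map_smul] at h2
      have h3 := neg_le_of_abs_le (abs_real_inner_le_norm (dualResidual b x t (θ + r • Δ) -
        dualResidual b x t θ - -(r • Matrix.toEuclideanLin (wCov (tilt b x θ) x) Δ)) Δ)
      have h4 := mul_le_mul_of_nonneg_right h2 (norm_nonneg Δ)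
      rw [inner_sub_left, inner_sub_left, inner_neg_left, inner_smul_left, conj_trivial,
        ← hinner] at h3
      have h5 : M / 2 * (r * ‖Δ‖) ^ 2 * ‖Δ‖ ≤ M / 2 * ‖Δ‖ ^ 3 := by
        calc (M : ℝ) / 2 * (r * ‖Δ‖) ^ 2 * ‖Δ‖ = r ^ 2 * (M / 2 * ‖Δ‖ ^ 3) := by ring
          _ ≤ 1 * (M / 2 * ‖Δ‖ ^ 3) :=
            mul_le_mul_of_nonneg_right (pow_le_one₀ hr.1.le hr.2.le) (by positivity)
          _ = _ := one_mul _
      linarith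
  have h6 := hpos θ hθ Δ
  rw [← hinner] at h6
  have h7 := mul_le_mul_of_nonneg_left h6 (sub_nonneg.2 hc)
  have h8 := mul_le_mul_of_nonneg_right hΔ (sq_nonneg ‖Δ‖)
  simp only [zero_smul, add_zero, one_smul] at h1
  rw [Armijo, one_smul]
  nlinarith

lemma exists_local_newton_step [Nonempty (Fin N)] (hb : ∀ i, 0 < b i) {c β : ℝ} (hc : c < 1 / 2)
    (hmax : IsMaxOn (dualObj b x t) univ θs) {m : ℝ} (hm : 0 < m) {M : ℝ≥0}
    {U : Set (EuclideanSpace ℝ (Fin K))} (hU : U ∈ 𝓝 θs)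
    (hpos : ∀ θ ∈ U, ∀ v, m * ‖v‖ ^ 2 ≤
      inner ℝ (Matrix.toEuclideanLin (wCov (tilt b x θ) x) v) v)
    (hM : LipschitzOnWith M (fderiv ℝ (∇ (dualObj b x t))) U) :
    ∃ r : ℝ, 0 < r ∧ ∀ θ Δ n, ‖θ - θs‖ < r → IsNewtonDir b x t 0 θ Δ →
      IsLeast {j : ℕ | Armijo b x t c θ Δ (β ^ j)} n →
      n = 0 ∧ ‖θ + Δ - θs‖ ≤ M / (2 * m) * ‖θ - θs‖ ^ 2 ∧ ‖θ + Δ - θs‖ ≤ 1 / 2 * ‖θ - θs‖ := by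
  obtain ⟨ρ, hρ, hball⟩ := Metric.mem_nhds_iff.1 hU
  have hc' : 0 < 1 / 2 - c := by linarith
  have hM0 : (0 : ℝ) < M + 1 := by positivity
  -- The radii in turn: stay in `U`; make `M / (2 * m) * ‖θ - θs‖` at most `1 / 2`; make the full
  -- step pass Armijo, given `‖Δ‖ ≤ 2 * ‖θ - θs‖`. Using `M + 1` covers `M = 0`.
  refine ⟨min ρ (min (m / (M + 1)) ((1 / 2 - c) * m / (M + 1))), by positivity,
    fun θ Δ n hθ hdir hn => ?_⟩
  obtain ⟨hθρ, hθ'⟩ := lt_min_iff.1 hθ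
  obtain ⟨hθm, hθc⟩ := lt_min_iff.1 hθ'
  rw [lt_div_iff₀ hM0] at hθm hθc
  have hs := convex_ball θs ρ
  have hpos' := fun θ (hθ : θ ∈ Metric.ball θs ρ) => hpos θ (hball hθ)
  have hM' := hM.mono hball
  have hθs : θs ∈ Metric.ball θs ρ := Metric.mem_ball_self hρ
  have hθb : θ ∈ Metric.ball θs ρ := mem_ball_iff_norm.2 hθρ
  have hq := hdir.norm_add_sub_le hb hs hm hpos' hM' hmax hθs hθb
  have hn0 := norm_nonneg (θ - θs)
  have hhalf : ‖θ + Δ - θs‖ ≤ 1 / 2 * ‖θ - θs‖ := by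
    refine hq.trans ?_
    rw [sq, ← mul_assoc]
    refine mul_le_mul_of_nonneg_right ?_ hn0
    rw [div_mul_eq_mul_div, div_le_iff₀ (by positivity)]
    linarith
  have hΔ : ‖Δ‖ ≤ 2 * ‖θ - θs‖ := by
    have := norm_sub_le (θ + Δ - θs) (θ - θs)
    rw [show θ + Δ - θs - (θ - θs) = Δ by abel] at this
    linarith
  have hA : Armijo b x t c θ Δ 1 := by
    refine hdir.armijo_one hb hs hpos' hM' hθb (mem_ball_iff_norm.2 (by linarith)) hc.le ?_
    have := mul_le_mul_of_nonneg_left hΔ (show (0 : ℝ) ≤ M / 2 by positivity)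
    linarith
  exact ⟨Nat.le_zero.1 (hn.2 (by simpa using hA)), hq, hhalf⟩

end Newton

/-! ### Assembly of the theorem -/

theorem mainTheorem4 {N K : ℕ} (b : Fin N → ℝ) (hb : ∀ i, 0 < b i)
    (hb1 : ∑ i, b i = 1)
    (x : Fin N → EuclideanSpace ℝ (Fin K)) (t : EuclideanSpace ℝ (Fin K))
    (ht : t ∈ intrinsicInterior ℝ (convexHull ℝ (range x)))
    (c β : ℝ) (hc0 : 0 < c) (hc1 : c < 1 / 2) (hβ0 : 0 < β) (hβ1 : β < 1) :
    -- the dual objective attains its maximum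
    (∃ θs, IsMaxOn (dualObj b x t) univ θs) ∧
    -- every step of the method is well defined
    (∀ (θ : EuclideanSpace ℝ (Fin K)) (δ : ℝ), 0 ≤ δ →
      (∃ Δ, IsNewtonDir b x t δ θ Δ) ∧
      ∀ Δ, IsNewtonDir b x t δ θ Δ → ∃ j : ℕ, Armijo b x t c θ Δ (β ^ j)) ∧
    -- global convergence, from an arbitrary starting point
    (∀ (δmax : ℝ) (δ : ℕ → ℝ) (θ Δ : ℕ → EuclideanSpace ℝ (Fin K)) (n : ℕ → ℕ),
      (∀ k, 0 ≤ δ k ∧ δ k ≤ δmax) → IsNewtonRun b x t c β δ θ Δ n →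
      Monotone (fun k => dualObj b x t (θ k)) ∧
      Tendsto (fun k => ∇ (dualObj b x t) (θ k)) atTop (𝓝 0) ∧
      Tendsto (fun k => wMean (tilt b x (θ k)) x) atTop (𝓝 t) ∧
      (∀ θs, IsMaxOn (dualObj b x t) univ θs →
        Tendsto (fun k => dualObj b x t (θ k)) atTop (𝓝 (dualObj b x t θs)) ∧
        Tendsto (fun k => tilt b x (θ k)) atTop (𝓝 (tilt b x θs))) ∧
      Tendsto (fun k => Metric.infDist (θ k) {θs | IsMaxOn (dualObj b x t) univ θs})
        atTop (𝓝 0) ∧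
      ((∀ k, Δ k ∈ LinearMap.range (Matrix.toEuclideanLin (wCov (tilt b x (θ k)) x))) →
        ∃ θs, IsMaxOn (dualObj b x t) univ θs ∧ Tendsto θ atTop (𝓝 θs))) ∧
    -- local quadratic convergence of the pure Newton iteration
    (∀ (θs : EuclideanSpace ℝ (Fin K)), IsMaxOn (dualObj b x t) univ θs →
      ∀ (m : ℝ) (M : ℝ≥0) (U : Set (EuclideanSpace ℝ (Fin K))), 0 < m → U ∈ 𝓝 θs →
      (∀ θ ∈ U, (wCov (tilt b x θ) x - m • (1 : Matrix (Fin K) (Fin K) ℝ)).PosSemidef) →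
      LipschitzOnWith M (fderiv ℝ (∇ (dualObj b x t))) U →
      (∃ r : ℝ, 0 < r ∧
        ∀ (θ Δ : ℕ → EuclideanSpace ℝ (Fin K)) (n : ℕ → ℕ),
          IsNewtonRun b x t c β (fun _ => 0) θ Δ n → ‖θ 0 - θs‖ < r →
          Tendsto θ atTop (𝓝 θs) ∧
          ∀ k, n k = 0 ∧ ‖θ (k + 1) - θs‖ ≤ (M : ℝ) / (2 * m) * ‖θ k - θs‖ ^ 2) ∧
      (∀ (δmax : ℝ) (δ : ℕ → ℝ) (θ Δ : ℕ → EuclideanSpace ℝ (Fin K)) (n : ℕ → ℕ),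
        (∀ k, 0 ≤ δ k ∧ δ k ≤ δmax) → (∀ᶠ k in atTop, δ k = 0) →
        IsNewtonRun b x t c β δ θ Δ n →
        Tendsto θ atTop (𝓝 θs) ∧
        ∀ᶠ k in atTop, n k = 0 ∧
          ‖θ (k + 1) - θs‖ ≤ (M : ℝ) / (2 * m) * ‖θ k - θs‖ ^ 2)) := by
  have : Nonempty (Fin N) := nonempty_of_sum_eq_one hb1
  replace ht := inner_eq_zero_of_mem_intrinsicInterior ht
  have hglobal : ∀ (δmax : ℝ) (δ : ℕ → ℝ) (θ Δ : ℕ → EuclideanSpace ℝ (Fin K)) (n : ℕ → ℕ),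
      (∀ k, 0 ≤ δ k ∧ δ k ≤ δmax) → IsNewtonRun b x t c β δ θ Δ n →
      ∃ θs ∈ centredSpan x t, IsMaxOn (dualObj b x t) univ θs ∧
        Tendsto (fun k => (centredSpan x t).starProjection (θ k)) atTop (𝓝 θs) := by
    intro δmax δ θ Δ n hδ hrun
    obtain ⟨θs, hs, hmax⟩ := exists_isMaxOn_dualObj hb hb1 ht
    exact ⟨θs, hs, hmax, (hrun.starProjection hb).tendsto_of_mem_centredSpan hb hb1 ht hc0
      (by linarith) hβ0 hδ (fun k => Submodule.starProjection_apply_mem _ _)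
      (fun k => Submodule.starProjection_apply_mem _ _) hs hmax⟩
  have hadd : ∀ θs, IsMaxOn (dualObj b x t) univ θs → ∀ θ,
      IsMaxOn (dualObj b x t) univ (θs + (θ - (centredSpan x t).starProjection θ)) := by
    intro θs hmax θ θ' _
    change dualObj b x t θ' ≤ dualObj b x t _
    rw [dualObj_add_of_inner_eq_zero hb _ (inner_sub_starProjection θ)]
    exact hmax (mem_univ θ')
  have hdist : ∀ (δmax : ℝ) (δ : ℕ → ℝ) (θ Δ : ℕ → EuclideanSpace ℝ (Fin K)) (n : ℕ → ℕ),
      (∀ k, 0 ≤ δ k ∧ δ k ≤ δmax) → IsNewtonRun b x t c β δ θ Δ n →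
      Tendsto (fun k => Metric.infDist (θ k) {θs | IsMaxOn (dualObj b x t) univ θs})
        atTop (𝓝 0) := by
    intro δmax δ θ Δ n hδ hrun
    obtain ⟨θp, hp, hmax, hlim⟩ := hglobal δmax δ θ Δ n hδ hrun
    refine squeeze_zero (fun k => Metric.infDist_nonneg) (fun k => ?_)
      (tendsto_iff_dist_tendsto_zero.1 hlim)
    -- Give the limit `θp` of the projections the orthogonal component of `θ k`: this is a maximizer
    -- whose distance to `θ k` is that from the projection of `θ k` to `θp`.
    refine (Metric.infDist_le_dist_of_mem
      (s := {θs | IsMaxOn (dualObj b x t) univ θs}) (hadd θp hmax (θ k))).trans_eq ?_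
    rw [dist_eq_norm, dist_eq_norm, ← sub_sub, sub_right_comm, sub_sub_cancel]
  refine ⟨?_, fun θ δ hδ => ⟨exists_isNewtonDir hb ht θ hδ, fun Δ h =>
    exists_armijo hb ht (by linarith) hβ0 hβ1 hδ h⟩, ?_, ?_⟩
  · obtain ⟨θs, _, h⟩ := exists_isMaxOn_dualObj hb hb1 ht
    exact ⟨θs, h⟩
  · intro δmax δ θ Δ n hδ hrun
    obtain ⟨θp, hp, hmax, hlim⟩ := hglobal δmax δ θ Δ n hδ hrun
    have hg : Tendsto (fun k => dualResidual b x t (θ k)) atTop (𝓝 0) := by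
      have := ((continuous_dualResidual (x := x) (t := t) hb).tendsto θp).comp hlim
      rw [dualResidual_eq_zero_of_isMaxOn hb hmax] at this
      exact this.congr fun k => dualResidual_starProjection hb (θ k)
    refine ⟨hrun.monotone hb hc0 hβ0 fun k => (hδ k).1, by rwa [gradient_dualObj hb], ?_,
      fun θs hθs => ⟨?_, ?_⟩, hdist δmax δ θ Δ n hδ hrun, fun hrange => ?_⟩
    · have := hg.const_sub t
      simpa [dualResidual] using this
    · have h1 : dualObj b x t θp = dualObj b x t θs :=
        le_antisymm (hθs (mem_univ _)) (hmax (mem_univ _))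
      rw [← h1]
      exact (((continuous_dualObj hb).tendsto θp).comp hlim).congr
        fun k => dualObj_starProjection hb (θ k)
    · have h1 := tilt_add_of_inner_eq_zero hb θp (inner_sub_eq_zero_of_isMaxOn hb hmax hθs)
      rw [add_sub_cancel] at h1
      rw [h1]
      exact (((continuous_tilt hb).tendsto θp).comp hlim).congr
        fun k => tilt_starProjection hb (θ k)
    -- Directions in the range of `Σ` lie in the span, so the orthogonal component stays that of `θ
    -- 0`.
    · refine ⟨θp + (θ 0 - (centredSpan x t).starProjection (θ 0)), hadd θp hmax (θ 0), ?_⟩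
      refine (hlim.add_const (θ 0 - (centredSpan x t).starProjection (θ 0))).congr fun k => ?_
      induction k with
      | zero => abel
      | succ k ih =>
        have hΔ : Δ k ∈ centredSpan x t := by
          obtain ⟨v, hv⟩ := hrange k
          rw [← hv]
          exact wCov_apply_mem_centredSpan (sum_tilt hb (θ k)) v
        rw [hrun.step k, map_add, map_smul, Submodule.starProjection_eq_self_iff.2 hΔ,
          add_right_comm, ih]
  · intro θs hmax m M U hm hU hpsd hLip
    have hpos := fun θ hθ => mul_norm_sq_le_of_posSemidef (hpsd θ hθ)
    obtain ⟨r, hr, hstep⟩ := exists_local_newton_step (β := β) hb hc1 hmax hm hU hpos hLip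
    refine ⟨⟨r, hr, fun θ Δ n hrun hθ0 => ?_⟩, fun δmax δ θ Δ n hδ hδ0 hrun => ?_⟩
    · have hloc : ∀ k, ‖θ k - θs‖ < r → n k = 0 ∧
          ‖θ (k + 1) - θs‖ ≤ M / (2 * m) * ‖θ k - θs‖ ^ 2 ∧
          ‖θ (k + 1) - θs‖ ≤ 1 / 2 * ‖θ k - θs‖ := fun k hk => by
        have h1 := hstep (θ k) (Δ k) (n k) hk (hrun.dir k) (hrun.search k)
        refine ⟨h1.1, ?_⟩
        rw [hrun.step k, h1.1, pow_zero, one_smul]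
        exact h1.2
      have hin : ∀ k, ‖θ k - θs‖ < r := fun k => by
        induction k with
        | zero => exact hθ0
        | succ k ih => linarith [(hloc k ih).2.2, norm_nonneg (θ k - θs)]
      have hgeom : ∀ k, ‖θ k - θs‖ ≤ (1 / 2 : ℝ) ^ k * r := fun k => by
        induction k with
        | zero => simpa using hθ0.le
        | succ k ih => rw [pow_succ']; linarith [(hloc k (hin k)).2.2]
      refine ⟨tendsto_iff_norm_sub_tendsto_zero.2 ?_, fun k =>
        ⟨(hloc k (hin k)).1, (hloc k (hin k)).2.1⟩⟩
      refine squeeze_zero (fun k => norm_nonneg _) hgeom ?_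
      simpa using (tendsto_pow_atTop_nhds_zero_of_lt_one (r := (1 / 2 : ℝ)) (by norm_num)
        (by norm_num)).mul_const r
    -- The difference of two maximizers is in the kernel of `Σ θs`, which is trivial by positive
    -- definiteness; distance to the maximizers is then distance to `θs`.
    · have huniq : {θ' | IsMaxOn (dualObj b x t) univ θ'} = {θs} := by
        refine Subset.antisymm (fun θ' hθ' => ?_) (by rintro _ rfl; exact hmax)
        have h1 := wCov_apply_eq_zero (sum_tilt (x := x) hb θs)
          (inner_sub_eq_zero_of_isMaxOn hb hmax hθ')
        have h2 := hpos θs (mem_of_mem_nhds hU) (θ' - θs)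
        rw [h1, inner_zero_left] at h2
        have h3 : ‖θ' - θs‖ ^ 2 ≤ 0 := nonpos_of_mul_nonpos_right h2 hm
        exact sub_eq_zero.1 (norm_eq_zero.1 (pow_eq_zero_iff two_ne_zero |>.1
          (h3.antisymm (sq_nonneg _))))
      have hlim : Tendsto θ atTop (𝓝 θs) := by
        have := hdist δmax δ θ Δ n hδ hrun
        rw [huniq] at this
        simpa only [Metric.infDist_singleton, ← tendsto_iff_dist_tendsto_zero] using this
      refine ⟨hlim, ?_⟩
      filter_upwards [hδ0, (tendsto_iff_norm_sub_tendsto_zero.1 hlim).eventually_lt_const hr]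
        with k hk hkr
      have hdir := hrun.dir k
      rw [hk] at hdir
      have h1 := hstep (θ k) (Δ k) (n k) hkr hdir (hrun.search k)
      refine ⟨h1.1, ?_⟩
      rw [hrun.step k, h1.1, pow_zero, one_smul]
      exact h1.2.1
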